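/- Let $p,s>0$. For $\operatorname{Re} z>0$ let $K_p(z)=\tfrac12\int_0^\infty t^{-p-1}e^{-\frac z2(t+1/t)}\,dt$ be the modified Bessel function of the second kind, and let $J_p$, $Y_p$ be the Bessel functions of the first and second kind. Define the following measures on $\mathbb C$. (i) For $0<|\alpha|<\pi/2$, $\nu_\alpha$ has density $f_\alpha$ with respect to Lebesgue measure, where $f_\alpha(z)=0$ off the cone $S_\alpha=\{z:|\arg z|\le|\alpha|\}$ and, for $z=re^{i\theta}\in S_\alpha$, $$f_\alpha(z)=c_{p,s}(\alpha)\,\frac{\sin(2|\alpha|)}{r^2\sin^2(\alpha+\theta)}\left[\frac{\sin(\alpha-\theta)}{\sin(\alpha+\theta)}\right]^{p-1}\exp\left\{-\frac{\sin(2\alpha)}{s}\left[\frac1{r\sin(\alpha-\theta)}+\frac r{\sin(\alpha+\theta)}\right]\right\},\qquad c_{p,s}(\alpha)=\frac1{|2K_p(2e^{i\alpha}/s)|^2}.$$ (ii) $\nu_0$ is the Letac--Seshadri generalised inverse Gaussian law, carried by $\mathbb R_+$, with density $\frac{1}{2K_p(2/s)}x^{-p-1}\exp\{-\frac1s(x+\frac1x)\}$,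 $x>0$, with respect to Lebesgue measure on $\mathbb R_+$. (iii) $\nu_{\pm\pi/2}$ is carried by the imaginary axis, and is the image under $y\mapsto iy$ of the measure on $\mathbb R$ with density $c\,f_\pm(y)$, where $c=\dfrac1{\pi^2[J_p^2(2/s)+Y_p^2(2/s)]}$, $$f_+(y)=\frac1{|y|^{p+1}}\exp\left[\frac1s\left(\frac1y-y\right)\right]\int_{c(y)}^y\exp\left[-\frac1s\left(\frac1t-t\right)\right]|t|^{p-1}\,dt,\qquad c(y)=\begin{cases}0&y>0\\-\infty&y<0\end{cases},$$ and $f_-(y)=f_+(-y)$. Then $\nu_0$, $\nu_\alpha$ ($0<|\alpha|<\pi/2$) and $\nu_{\pm\pi/2}$ are probability measures. If $X$, $Z_\alpha$ and $iY_\pm$ are random variables with laws $\nu_0$, $\nu_\alpha$ and $\nu_{\pm\pi/2}$ respectively, then, in distribution, $$Z_\alpha\to X\ \ (\alpha\to0),\qquad Z_\alpha\to iY_+\ \ (\alpha\to\tfrac\pi2-),\qquad Z_\alpha\to iY_-\ \ (\alpha\to-\tfrac\pi2+).$$ Moreover $f_\pm$ are integrable, with positive integral, and the normalisation constant at $\alpha=\pm\pi/2$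 is $$\left(\int_{\mathbb R}f_\pm(y)\,dy\right)^{-1}=\lim_{\alpha\to\pi/2-}c_{p,s}(\alpha)=\lim_{\alpha\to-\pi/2+}c_{p,s}(\alpha)=\frac1{\pi^2[J_p^2(2/s)+Y_p^2(2/s)]}.$$ -/

import Mathlib

open Real MeasureTheory ProbabilityTheory Filter Topology

noncomputable section

/-- Modified Bessel function of the second kind (Macdonald function) `K_ν(z)`, of real order `ν`,
on the half-plane `0 < re z`:
`K_ν(z) = (1/2) ∫_0^∞ t^(-ν-1) exp (-(z/2) (t + 1/t)) dt`. -/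
def besselK (ν : ℝ) (z : ℂ) : ℂ :=
  (1 / 2) * ∫ t in Set.Ioi (0 : ℝ),
    ((t ^ (-ν - 1) : ℝ) : ℂ) * Complex.exp (-(z / 2) * ((t + 1 / t : ℝ) : ℂ))

/-- Bessel function of the first kind `J_ν(x)`, for every real order `ν` and every `x > 0`
(the Bessel–Schläfli integral). -/
def besselJ (ν x : ℝ) : ℝ :=
  (1 / π) * (∫ θ in (0 : ℝ)..π, cos (ν * θ - x * sin θ))
    - (sin (ν * π) / π) * ∫ t in Set.Ioi (0 : ℝ), exp (-x * sinh t - ν * t)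

/-- Bessel function of the second kind (Weber function) `Y_ν(x)`, for every real order `ν`
(integers included) and every `x > 0` (Schläfli's integral). -/
def besselY (ν x : ℝ) : ℝ :=
  (1 / π) * (∫ θ in (0 : ℝ)..π, sin (x * sin θ - ν * θ))
    - (1 / π) * ∫ t in Set.Ioi (0 : ℝ),
        (exp (ν * t) + exp (-ν * t) * cos (ν * π)) * exp (-x * sinh t)

/-- The closed cone `S_α = {z : |arg z| ≤ |α|}`. -/
def coneS (α : ℝ) : Set ℂ := {z | |Complex.arg z| ≤ |α|}

/-- The constant `c_{p,s}(α) = 1 / |2 K_p(2 e^{iα} / s)|²`, for `|α| < π/2`. -/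
def normConst (p s α : ℝ) : ℝ :=
  1 / ‖2 * besselK p (2 * Complex.exp (Complex.I * α) / s)‖ ^ 2

/-- The density `f_α` with respect to Lebesgue measure on `ℂ`, for `0 < |α| < π/2`,
extended by `0` outside `S_α`; here `r = |z|` and `θ = arg z`. -/
def densityAlpha (p s α : ℝ) : ℂ → ℝ :=
  (coneS α).indicator fun z =>
    let r := ‖z‖
    let θ := Complex.arg z
    normConst p s α * sin (2 * |α|) * (1 / (r ^ 2 * sin (α + θ) ^ 2))
      * (sin (α - θ) / sin (α + θ)) ^ (p - 1)
      * exp (-(sin (2 * α) / s) * (1 / (r * sin (α - θ)) + r / sin (α + θ)))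

/-- The measure `ν_α` on `ℂ`, for `0 < |α| < π/2`. -/
def nuAlpha (p s α : ℝ) : Measure ℂ :=
  (volume : Measure ℂ).withDensity fun z => ENNReal.ofReal (densityAlpha p s α z)

/-- The Letac–Seshadri (generalised inverse Gaussian) density `f_0` on `(0, ∞)`. -/
def densityZero (p s x : ℝ) : ℝ :=
  1 / (2 * (besselK p ((2 / s : ℝ) : ℂ)).re) * x ^ (-p - 1) * exp (-(1 / s) * (x + 1 / x))

/-- The generalised inverse Gaussian law `ν_0`, carried by the positive half-line in `ℂ`. -/
def nuZero (p s : ℝ) : Measure ℂ :=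
  (((volume : Measure ℝ).restrict (Set.Ioi 0)).withDensity
    fun x => ENNReal.ofReal (densityZero p s x)).map fun x : ℝ => (x : ℂ)

/-- The function `f_+` on `ℝ`:
`|y|^(-p-1) exp ((1/s)(1/y - y)) ∫_{c(y)}^y |t|^(p-1) exp (-(1/s)(1/t - t)) dt`,
with `c(y) = 0` for `y > 0` and `c(y) = -∞` for `y < 0`. The variables `y` and `t` have the
same sign, so that `t^(p-1) / y^(p+1)` is read as `|t|^(p-1) / |y|^(p+1)`. -/
def fPlus (p s y : ℝ) : ℝ :=
  1 / |y| ^ (p + 1) * exp ((1 / s) * (1 / y - y))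
    * ∫ t in (if 0 < y then Set.Ioo 0 y else Set.Iio y),
        exp (-(1 / s) * (1 / t - t)) * |t| ^ (p - 1)

/-- The function `f_-(y) = f_+(-y)`. -/
def fMinus (p s y : ℝ) : ℝ := fPlus p s (-y)

/-- The constant `1 / (π² (J_p(2/s)² + Y_p(2/s)²))`. -/
def normConstPiHalf (p s : ℝ) : ℝ :=
  1 / (π ^ 2 * (besselJ p (2 / s) ^ 2 + besselY p (2 / s) ^ 2))

/-- The measure `ν_{π/2}`, carried by the imaginary axis in `ℂ`. -/
def nuPiHalf (p s : ℝ) : Measure ℂ :=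
  ((volume : Measure ℝ).withDensity
    fun y => ENNReal.ofReal (normConstPiHalf p s * fPlus p s y)).map
      fun y : ℝ => Complex.I * (y : ℂ)

/-- The measure `ν_{-π/2}`, carried by the imaginary axis in `ℂ`. -/
def nuNegPiHalf (p s : ℝ) : Measure ℂ :=
  ((volume : Measure ℝ).withDensity
    fun y => ENNReal.ofReal (normConstPiHalf p s * fMinus p s y)).map
      fun y : ℝ => Complex.I * (y : ℂ)

/-- The parameter range `0 < |α| < π/2`. -/
abbrev AlphaRange : Type := {α : ℝ // 0 < |α| ∧ |α| < π / 2}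

end

/-! All the laws belong to one family indexed by every real angle. Write a point of the cone as `u
e^{iα} + v e^{-iα}` with `u, v > 0`. Then `r sin(α+θ) = u sin 2α` and `r sin(α-θ) = v sin 2α`, and
the density of `ν_α` becomes a multiple of `coneWeight`, which has no singularity at `α = 0` or `α =
±π/2`; there only the linear map `coneMap` degenerates, onto the real or the imaginary axis. So
`coneLaw p s α` makes sense for every `α`, and the theorem reduces to its weak continuity in `α`
(`continuous_coneLaw`) and to identifying it with the given measures.

Continuity is dominated convergence: since `cos 2α ≥ -1`, the weight at `π/2` dominates all the
others. Its integrability comes from the exact masses. For `|α| < π/2`, `lintegral_coneWeight`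
evaluates the mass as `|2 K_p(2e^{iα}/s)|²`, by writing the square as a double integral and rotating
a contour. `tendsto_norm_besselK_sq` shows that this tends to `π²(J_p² + Y_p²)` as `α → π/2`, and
Fatou then gives a finite mass at `π/2`. Continuity of the mass turns this bound into an equality.

The identifications (`nuAlpha_eq_coneLaw`, `nuZero_eq_coneLaw`, `nuPiHalf_eq_coneLaw`,
`nuNegPiHalf_eq_coneLaw`) are a linear change of variables for `0 < |α| < π/2`, and otherwise an
integration of the weight along the lines where `u + v` or `u - v` is constant. -/

/-! ### Decay estimates and contour shifts -/

/-- Super-exponential decay dominates every exponential on the half-line. -/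
lemma exp_sub_mul_exp_le (ν : ℝ) {k : ℝ} (hk : 0 < k) {t : ℝ} (ht : 0 ≤ t) :
    exp (ν * t - k * exp t) ≤ exp ((ν + 1) ^ 2 / (2 * k)) * exp (-t) := by
  rw [← exp_add]
  apply exp_le_exp.2
  have h1 : 1 + t + t ^ 2 / 2 ≤ exp t := quadratic_le_exp_of_nonneg ht
  have h2 : k * (t ^ 2 / 2) ≤ k * exp t := by
    apply mul_le_mul_of_nonneg_left _ hk.le; linarith
  -- Completing the square in `t` produces the constant.
  have h3 : (ν + 1) * t - k * t ^ 2 / 2 ≤ (ν + 1) ^ 2 / (2 * k) := by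
    rw [le_div_iff₀ (by positivity)]
    nlinarith [sq_nonneg (k * t - (ν + 1))]
  linarith

lemma integrable_exp_neg_abs : Integrable (fun t : ℝ => exp (-|t|)) := by
  have h : IntegrableOn (fun t : ℝ => exp (-|t|)) (Set.Ioi 0) :=
    (integrableOn_exp_neg_Ioi 0).congr_fun (fun t ht => by
      simp only [abs_of_pos (Set.mem_Ioi.1 ht)]) measurableSet_Ioi
  have h' : IntegrableOn (fun t : ℝ => exp (-|t|)) (Set.Iic 0) :=
    (integrableOn_exp_Iic 0).congr_fun (fun t ht => by
      simp only [abs_of_nonpos (Set.mem_Iic.1 ht), neg_neg]) measurableSet_Iic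
  rw [← integrableOn_univ, ← Set.Iic_union_Ioi (a := (0 : ℝ))]
  exact h'.union h

lemma integrable_of_norm_le_exp_neg_abs {f : ℝ → ℂ} (hf : Continuous f) {C : ℝ}
    (h : ∀ t, ‖f t‖ ≤ C * exp (-|t|)) : Integrable f :=
  (integrable_exp_neg_abs.const_mul C).mono' hf.aestronglyMeasurable (ae_of_all _ h)

lemma integral_eq_integral_Ioi_add {f : ℝ → ℂ} (hf : Integrable f) :
    ∫ t, f t = (∫ t in Set.Ioi 0, f t) + ∫ t in Set.Ioi 0, f (-t) := by
  rw [integral_comp_neg_Ioi, neg_zero, add_comm,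
    intervalIntegral.integral_Iic_add_Ioi hf.integrableOn hf.integrableOn]

/-- Cauchy's theorem on a half-strip. -/
lemma integral_Ioi_sub_integral_Ioi_of_le_exp {f : ℂ → ℂ} (hf : Differentiable ℂ f) {a b C : ℝ}
    (hC : ∀ t : ℝ, 0 ≤ t → ∀ φ ∈ Set.uIcc a b, ‖f (t + φ * Complex.I)‖ ≤ C * exp (-t)) :
    (∫ t in Set.Ioi (0 : ℝ), f (t + a * Complex.I)) -
      (∫ t in Set.Ioi (0 : ℝ), f (t + b * Complex.I)) =
    Complex.I * ∫ y in a..b, f (y * Complex.I) := by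
  have hint : ∀ φ ∈ Set.uIcc a b,
      IntegrableOn (fun t : ℝ => f (t + φ * Complex.I)) (Set.Ioi 0) := by
    intro φ hφ
    refine ((integrableOn_exp_neg_Ioi 0).const_mul C).mono' ?_ ?_
    · have := hf.continuous
      exact Continuous.aestronglyMeasurable (by fun_prop)
    · filter_upwards [ae_restrict_mem measurableSet_Ioi] with t ht
      exact hC t (le_of_lt ht) φ hφ
  have hlim : ∀ φ ∈ Set.uIcc a b,
      Tendsto (fun T : ℝ => ∫ t in (0 : ℝ)..T, f (t + φ * Complex.I)) atTop
        (𝓝 (∫ t in Set.Ioi (0 : ℝ), f (t + φ * Complex.I))) := fun φ hφ =>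
    intervalIntegral_tendsto_integral_Ioi 0 (hint φ hφ) tendsto_id
  have hside : Tendsto (fun T : ℝ => ∫ y in a..b, f (T + y * Complex.I)) atTop (𝓝 0) := by
    have h0 : Tendsto (fun T : ℝ => C * exp (-T) * |b - a|) atTop (𝓝 0) := by
      have := (tendsto_exp_neg_atTop_nhds_zero.const_mul C).mul_const |b - a|
      simpa using this
    refine squeeze_zero_norm' ?_ h0
    filter_upwards [eventually_ge_atTop 0] with T hT
    refine intervalIntegral.norm_integral_le_of_norm_le_const fun y hy => ?_
    exact hC T hT y (Set.uIoc_subset_uIcc hy)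
  have hrect : ∀ T : ℝ, (∫ t in (0 : ℝ)..T, f (t + a * Complex.I)) -
      (∫ t in (0 : ℝ)..T, f (t + b * Complex.I)) +
      Complex.I * (∫ y in a..b, f (T + y * Complex.I)) =
      Complex.I * ∫ y in a..b, f (y * Complex.I) := by
    intro T
    have := Complex.integral_boundary_rect_eq_zero_of_differentiableOn f ⟨0, a⟩ ⟨T, b⟩
      hf.differentiableOn
    simp only [smul_eq_mul, Complex.ofReal_zero, zero_add] at this
    linear_combination this
  have h1 := ((hlim a Set.left_mem_uIcc).sub (hlim b Set.right_mem_uIcc)).add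
    (hside.const_mul Complex.I)
  simp only [hrect] at h1
  have := tendsto_nhds_unique h1 tendsto_const_nhds
  rw [← this]; ring

/-- Shifting the line of integration of an entire function that decays on a strip. -/
lemma integral_add_mul_I_of_le_exp {f : ℂ → ℂ} (hf : Differentiable ℂ f) {b C : ℝ}
    (hC : ∀ t : ℝ, ∀ φ ∈ Set.uIcc 0 b, ‖f (t + φ * Complex.I)‖ ≤ C * exp (-|t|)) :
    ∫ t : ℝ, f (t + b * Complex.I) = ∫ t : ℝ, f t := by
  have hc := hf.continuous
  have hi : ∀ φ ∈ Set.uIcc 0 b, Integrable fun t : ℝ => f (t + φ * Complex.I) := fun φ hφ =>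
    integrable_of_norm_le_exp_neg_abs (by fun_prop) fun t => hC t φ hφ
  have h0 := hi 0 Set.left_mem_uIcc
  simp only [Complex.ofReal_zero, zero_mul, add_zero] at h0
  rw [integral_eq_integral_Ioi_add (hi b Set.right_mem_uIcc), integral_eq_integral_Ioi_add h0]
  have h1 := integral_Ioi_sub_integral_Ioi_of_le_exp hf (a := 0) (b := b) (C := C)
    fun t ht φ hφ => by simpa [abs_of_nonneg ht] using hC t φ hφ
  -- The left half-line is the right one for `z ↦ f (-z)`. Both half-strips contribute the same
  -- vertical segment, with opposite signs.
  have h2 := integral_Ioi_sub_integral_Ioi_of_le_exp (f := fun z => f (-z))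
    (hf.comp differentiable_neg) (a := -b) (b := 0) (C := C) fun t ht φ hφ => by
      have := hC (-t) (-φ) (by
        rw [Set.mem_uIcc] at hφ ⊢
        rcases hφ with h | h
        · left; constructor <;> linarith
        · right; constructor <;> linarith)
      rw [abs_neg, abs_of_nonneg ht] at this
      convert this using 3
      push_cast; ring
  have h3 : ∫ y in (-b)..0, f (-(y * Complex.I)) = ∫ y in (0:ℝ)..b, f (y * Complex.I) := by
    have := intervalIntegral.integral_comp_neg (a := -b) (b := 0)
      (fun y : ℝ => f (y * Complex.I))
    simpa using this
  rw [h3] at h2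
  have e1 : ∀ t : ℝ, -((t : ℂ) + ((-b : ℝ) : ℂ) * Complex.I) = ((-t : ℝ) : ℂ) + b * Complex.I := by
    intro t; push_cast; ring
  have e2 : ∀ t : ℝ, -((t : ℂ) + ((0 : ℝ) : ℂ) * Complex.I) = ((-t : ℝ) : ℂ) := by
    intro t; push_cast; ring
  simp only [e1, e2] at h2
  simp only [Complex.ofReal_zero, zero_mul, add_zero] at h1
  linear_combination h2 - h1

/-! ### Logarithmic coordinates and the Macdonald function -/

lemma lintegral_Ioi_eq_lintegral_exp (g : ℝ → ENNReal) :
    ∫⁻ t in Set.Ioi (0 : ℝ), g t = ∫⁻ t, ENNReal.ofReal (exp t) * g (exp t) := by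
  have := lintegral_image_eq_lintegral_abs_deriv_mul MeasurableSet.univ
    (fun x _ => (Real.hasDerivAt_exp x).hasDerivWithinAt) Real.exp_injective.injOn g
  rw [Set.image_univ, Real.range_exp, Measure.restrict_univ] at this
  simpa only [abs_exp] using this

lemma integral_Ioi_eq_integral_exp (g : ℝ → ℂ) :
    ∫ t in Set.Ioi (0 : ℝ), g t = ∫ t, (exp t : ℂ) * g (exp t) := by
  have := integral_image_eq_integral_abs_deriv_smul MeasurableSet.univ
    (fun x _ => (Real.hasDerivAt_exp x).hasDerivWithinAt) Real.exp_injective.injOn g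
  rw [Set.image_univ, Real.range_exp, Measure.restrict_univ] at this
  simpa only [abs_exp, Complex.real_smul, Complex.ofReal_exp] using this

/-- The Macdonald function in logarithmic coordinates. -/
lemma two_mul_besselK (ν : ℝ) (z : ℂ) :
    2 * besselK ν z = ∫ t : ℝ, Complex.exp (-ν * t - z * Complex.cosh t) := by
  rw [besselK, integral_Ioi_eq_integral_exp, ← mul_assoc]
  norm_num
  refine integral_congr_ae (ae_of_all _ fun t => ?_)
  simp only
  rw [← Real.exp_mul, Complex.ofReal_exp, ← Complex.exp_add, ← Complex.exp_add, Complex.cosh,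
    Complex.exp_neg]
  congr 1
  push_cast
  ring

lemma two_mul_besselK' (ν : ℝ) (z : ℂ) :
    2 * besselK ν z = ∫ t : ℝ, Complex.exp (ν * t - z * Complex.cosh t) := by
  rw [two_mul_besselK, ← integral_neg_eq_self]
  refine integral_congr_ae (ae_of_all _ fun t => ?_)
  simp

lemma norm_exp_sub_mul_cosh_le (ν : ℝ) {z : ℂ} (hz : 0 < z.re) (t : ℝ) :
    ‖Complex.exp (ν * t - z * Complex.cosh t)‖ ≤
      exp ((|ν| + 1) ^ 2 / z.re) * exp (-|t|) := by
  have h := exp_sub_mul_exp_le |ν| (half_pos hz) (abs_nonneg t)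
  have e : 2 * (z.re / 2) = z.re := by ring
  rw [e] at h
  refine le_trans ?_ h
  rw [Complex.norm_exp]
  apply exp_le_exp.2
  have : (ν * t - z * Complex.cosh t : ℂ).re = ν * t - z.re * Real.cosh t := by
    rw [← Complex.ofReal_cosh]; simp
  rw [this]
  have h1 : ν * t ≤ |ν| * |t| := by rw [← abs_mul]; exact le_abs_self _
  have h2 : exp |t| / 2 ≤ Real.cosh t := by
    rw [← Real.cosh_abs, Real.cosh_eq]; linarith [exp_pos (-|t|)]
  have := mul_le_mul_of_nonneg_left h2 hz.le
  linarith

lemma integrable_exp_sub_mul_cosh (ν : ℝ) {z : ℂ} (hz : 0 < z.re) :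
    Integrable fun t : ℝ => Complex.exp (ν * t - z * Complex.cosh t) :=
  integrable_of_norm_le_exp_neg_abs (by fun_prop) (norm_exp_sub_mul_cosh_le ν hz)

lemma besselK_conj (ν : ℝ) (z : ℂ) :
    besselK ν ((starRingEnd ℂ) z) = (starRingEnd ℂ) (besselK ν z) := by
  have h : 2 * besselK ν ((starRingEnd ℂ) z) = (starRingEnd ℂ) (2 * besselK ν z) := by
    rw [two_mul_besselK, two_mul_besselK, ← integral_conj]
    refine integral_congr_ae (ae_of_all _ fun t => ?_)
    simp only [← Complex.exp_conj, map_sub, map_mul, map_neg, Complex.conj_ofReal,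
      ← Complex.cosh_conj]
  rw [map_mul, map_ofNat] at h
  exact mul_left_cancel₀ two_ne_zero h

/-- Moving the line of integration up by `φ` multiplies the two coefficients by `e^{iφ}` and
`e^{-iφ}`. Between the two lines the real parts keep the factor `cos ψ ≥ cos φ > 0`, so the
integrand still decays in both directions. -/
lemma integral_rotate_exp {a b φ : ℝ} (ha : 0 < a) (hb : 0 < b) (hφ : |φ| < π / 2) :
    ∫ t : ℝ, Complex.exp (-(a * Complex.exp (φ * Complex.I)) * Complex.exp t
        - b * Complex.exp (-(φ * Complex.I)) * Complex.exp (-t)) =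
      ∫ t : ℝ, Complex.exp (-a * Complex.exp t - b * Complex.exp (-t)) := by
  have hcos : 0 < cos φ := cos_pos_of_mem_Ioo (abs_lt.1 hφ)
  set k : ℝ := cos φ * min a b with hk
  have hk0 : 0 < k := mul_pos hcos (lt_min ha hb)
  have key := integral_add_mul_I_of_le_exp
    (f := fun z => Complex.exp (-a * Complex.exp z - b * Complex.exp (-z))) (by fun_prop)
    (b := φ) (C := exp ((0 + 1) ^ 2 / (2 * k))) (fun t ψ hψ => by
      refine le_trans ?_ (exp_sub_mul_exp_le 0 hk0 (abs_nonneg t))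
      rw [Complex.norm_exp]
      apply exp_le_exp.2
      have hre : (-a * Complex.exp (t + ψ * Complex.I)
          - b * Complex.exp (-(t + ψ * Complex.I)) : ℂ).re =
          - (cos ψ * (a * exp t + b * exp (-t))) := by
        simp [Complex.exp_re]
        ring
      rw [hre]
      have hψ' : |ψ| ≤ |φ| := by
        rcases Set.mem_uIcc.1 hψ with h | h
        · rw [abs_of_nonneg h.1, abs_of_nonneg (h.1.trans h.2)]; exact h.2
        · rw [abs_of_nonpos h.2, abs_of_nonpos (h.1.trans h.2)]; linarith
      have hc : cos φ ≤ cos ψ := by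
        rw [← cos_abs φ, ← cos_abs ψ]
        exact cos_le_cos_of_nonneg_of_le_pi (abs_nonneg _) (by linarith [pi_pos]) hψ'
      have hm : min a b * exp |t| ≤ a * exp t + b * exp (-t) := by
        rcases abs_cases t with h | h <;> rw [h.1]
        · have := mul_le_mul_of_nonneg_right (min_le_left a b) (exp_pos t).le
          have := mul_pos hb (exp_pos (-t))
          linarith
        · have := mul_le_mul_of_nonneg_right (min_le_right a b) (exp_pos (-t)).le
          have := mul_pos ha (exp_pos t)
          linarith
      have := mul_le_mul hc hm (by positivity) (hcos.le.trans hc)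
      rw [hk]
      linarith)
  rw [← key]
  refine integral_congr_ae (ae_of_all _ fun t => ?_)
  simp only [neg_add, Complex.exp_add]
  congr 1
  ring

/-- The two coefficients have opposite arguments, so a single shift by `arg A` makes both positive.
-/
lemma integral_exp_conj {A : ℂ} (hA : 0 < A.re) (l : ℝ) {s : ℝ} (hs : 0 < s) :
    ∫ t : ℝ, Complex.exp (-A * Complex.exp t
        - (starRingEnd ℂ) A * Complex.exp (-l) * Complex.exp (-t)) =
      ((∫ y : ℝ, exp (-(1 / s) * exp (-y) - s * ‖A‖ ^ 2 * exp (-l) * exp y) : ℝ) : ℂ) := by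
  have hA0 : A ≠ 0 := by rintro rfl; simp at hA
  have hn : 0 < ‖A‖ := norm_pos_iff.2 hA0
  have h1 := integral_rotate_exp (a := ‖A‖) (b := ‖A‖ * exp (-l)) (φ := A.arg) hn
    (by positivity) (Complex.abs_arg_lt_pi_div_two_iff.2 (Or.inl hA))
  have hAe : (‖A‖ : ℂ) * Complex.exp (A.arg * Complex.I) = A := Complex.norm_mul_exp_arg_mul_I A
  have hAc : (‖A‖ : ℂ) * Complex.exp (-(A.arg * Complex.I)) = (starRingEnd ℂ) A := by
    conv_rhs => rw [← hAe]
    rw [map_mul, ← Complex.exp_conj]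
    simp
  have hAc' : ((‖A‖ * exp (-l) : ℝ) : ℂ) * Complex.exp (-(A.arg * Complex.I)) =
      (starRingEnd ℂ) A * Complex.exp (-l) := by
    rw [← hAc]; push_cast; ring
  rw [hAe, hAc'] at h1
  -- Only the product of the two coefficients matters up to translation. This reflection and
  -- translation normalises the one of `exp (-y)` to `1 / s`, as in `coneWeight`.
  rw [h1, ← integral_complex_ofReal, ← integral_sub_left_eq_self _ _ (-log (s * ‖A‖))]
  refine integral_congr_ae (ae_of_all _ fun y => ?_)
  have hsA : 0 < s * ‖A‖ := by positivity
  have e1 : exp (-log (s * ‖A‖) - y) = (s * ‖A‖)⁻¹ * exp (-y) := by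
    rw [sub_eq_add_neg, exp_add, exp_neg, exp_log hsA]
  have e2 : exp (-(-log (s * ‖A‖) - y)) = s * ‖A‖ * exp y := by
    rw [neg_sub, sub_neg_eq_add, exp_add, exp_log hsA, mul_comm]
  simp only
  rw [← Complex.ofReal_neg, ← Complex.ofReal_neg, ← Complex.ofReal_exp, ← Complex.ofReal_exp, e1, e2,
    ← Complex.ofReal_mul, ← Complex.ofReal_mul, ← Complex.ofReal_sub, ← Complex.ofReal_exp]
  congr 2
  field_simp

/-! ### The weight on the quadrant and its total mass -/

/-- Unnormalised density of the coordinates `(u, v)` of `z = u e^{iα} + v e^{-iα}` under `ν_α`. -/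
noncomputable def coneWeight (p s α u v : ℝ) : ℝ :=
  u ^ (-p - 1) * v ^ (p - 1) * exp (-(1 / s) * (1 / v + u + v ^ 2 / u + 2 * v * cos (2 * α)))

@[fun_prop]
lemma measurable_coneWeight (p s α : ℝ) :
    Measurable fun z : ℝ × ℝ => coneWeight p s α z.1 z.2 := by
  unfold coneWeight
  fun_prop

lemma coneWeight_pos (p s α : ℝ) {u v : ℝ} (hu : 0 < u) (hv : 0 < v) :
    0 < coneWeight p s α u v := by
  unfold coneWeight
  positivity

lemma exp_mul_exp_mul_coneWeight (p s α l y : ℝ) :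
    exp y * (exp (y + l) * coneWeight p s α (exp (y + l)) (exp y)) =
      exp (-p * l) * exp (-(1 / s) * exp (-y)
        - 1 / s * (exp l + exp (-l) + 2 * cos (2 * α)) * exp y) := by
  unfold coneWeight
  rw [← exp_mul, ← exp_mul, ← exp_add, ← exp_add, ← exp_add, ← exp_add, ← exp_add]
  congr 1
  have e1 : 1 / exp y = exp (-y) := by rw [exp_neg, one_div]
  have e2 : exp y ^ 2 / exp (y + l) = exp y * exp (-l) := by
    rw [exp_add, exp_neg]; field_simp
  rw [e1, e2, exp_add]
  ring

/-- The total mass of the weight is the squared modulus of the Macdonald function. -/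
lemma lintegral_coneWeight {p s α : ℝ} (hs : 0 < s) (hα : |α| < π / 2) :
    ∫⁻ v in Set.Ioi (0 : ℝ), ∫⁻ u in Set.Ioi (0 : ℝ), ENNReal.ofReal (coneWeight p s α u v) =
      ENNReal.ofReal (‖2 * besselK p (2 * Complex.exp (Complex.I * α) / s)‖ ^ 2) := by
  have hcos : 0 < cos α := cos_pos_of_mem_Ioo (abs_lt.1 hα)
  set ζ : ℂ := ⟨cos α / s, sin α / s⟩ with hζ
  have hz : 2 * Complex.exp (Complex.I * α) / s = 2 * ζ := by
    rw [mul_comm Complex.I]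
    have hs' : (s : ℂ) ≠ 0 := by exact_mod_cast hs.ne'
    rw [hζ, Complex.exp_mul_I, Complex.mk_eq_add_mul_I]
    push_cast
    field_simp
  rw [hz]
  set c : ℝ → ℝ := fun l => exp l + exp (-l) + 2 * cos (2 * α) with hc
  -- With `a = l + b` in the double integral for `|2K|²`, `A l` is the coefficient of `exp b`. That
  -- of `exp (-b)` is `conj (A l) * exp (-l)`.
  set A : ℝ → ℂ := fun l => ζ * exp l + (starRingEnd ℂ) ζ with hA
  have hAre : ∀ l, 0 < (A l).re := by
    intro l
    have : (A l).re = cos α / s * exp l + cos α / s := by simp [hA, hζ, -Complex.ofReal_exp]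
    rw [this]; positivity
  have hAn : ∀ l, s * ‖A l‖ ^ 2 * exp (-l) = 1 / s * c l := by
    intro l
    have h1 : (A l).re = cos α / s * exp l + cos α / s := by simp [hA, hζ, -Complex.ofReal_exp]
    have h2 : (A l).im = sin α / s * exp l - sin α / s := by
      simp [hA, hζ, -Complex.ofReal_exp]; ring
    simp only [hc]
    rw [Complex.sq_norm, Complex.normSq_apply, h1, h2, cos_two_mul', exp_neg]
    have := sin_sq_add_cos_sq α
    field_simp
    linear_combination (exp l ^ 2 + 1) * this
  have hc0 : ∀ l, 0 < c l := by
    intro l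
    have h := hAn l
    have h0 : 0 < ‖A l‖ := norm_pos_iff.2 fun h => by have := hAre l; rw [h] at this; simp at this
    have : 0 < 1 / s * c l := h ▸ by positivity
    exact (pos_iff_pos_of_mul_pos this).1 (by positivity)
  set E : ℝ → ℝ → ℝ := fun l y => exp (-p * l) * exp (-(1 / s) * exp (-y) - 1 / s * c l * exp y)
    with hE
  have hEi : ∀ l, Integrable (E l) := by
    intro l
    have hk : 0 < min (1 / s) (1 / s * c l) := lt_min (by positivity) (mul_pos (by positivity) (hc0 l))
    refine ((integrable_exp_neg_abs.const_mul
      (exp ((0 + 1) ^ 2 / (2 * min (1 / s) (1 / s * c l))))).mono' (by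
        apply Continuous.aestronglyMeasurable; fun_prop) (ae_of_all _ fun y => ?_)).const_mul _
    refine le_trans ?_ (exp_sub_mul_exp_le 0 hk (abs_nonneg y))
    rw [norm_of_nonneg (exp_pos _).le]
    apply exp_le_exp.2
    have h1 : 0 < 1 / s * exp (-y) := by positivity
    have h2 : 0 < 1 / s * c l * exp y := mul_pos (mul_pos (by positivity) (hc0 l)) (exp_pos _)
    rcases abs_cases y with h | h <;> rw [h.1]
    · have := mul_le_mul_of_nonneg_right (min_le_right (1 / s) (1 / s * c l)) (exp_pos y).le
      linarith
    · have := mul_le_mul_of_nonneg_right (min_le_left (1 / s) (1 / s * c l)) (exp_pos (-y)).le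
      linarith
  have step1 : ∫⁻ v in Set.Ioi (0 : ℝ), ∫⁻ u in Set.Ioi (0 : ℝ),
      ENNReal.ofReal (coneWeight p s α u v) = ∫⁻ l, ∫⁻ y, ENNReal.ofReal (E l y) := by
    rw [lintegral_Ioi_eq_lintegral_exp]
    simp only [lintegral_Ioi_eq_lintegral_exp (fun u => ENNReal.ofReal (coneWeight p s α u _))]
    -- The coordinates are `v = exp y` and `u = exp (y + l)`, so `l = log (u / v)`.
    rw [lintegral_lintegral_swap (by simp only [hE, hc]; fun_prop)]
    refine lintegral_congr fun y => ?_
    rw [← lintegral_add_left_eq_self _ y, ← lintegral_const_mul _ (by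
      have := measurable_coneWeight p s α
      have h2 : Measurable fun l : ℝ => (exp (y + l), exp y) := by fun_prop
      have := this.comp h2
      simp only [Function.comp_def] at this
      fun_prop)]
    refine lintegral_congr fun l => ?_
    rw [← ENNReal.ofReal_mul (exp_pos _).le, ← ENNReal.ofReal_mul (exp_pos _).le,
      exp_mul_exp_mul_coneWeight]
  have step2 : ∀ l, ∫⁻ y, ENNReal.ofReal (E l y) = ENNReal.ofReal (∫ y, E l y) := fun l =>
    (ofReal_integral_eq_lintegral_ofReal (hEi l) (ae_of_all _ fun y => by
      simp only [hE, Pi.zero_apply]; positivity)).symm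
  -- The squared modulus is `K(2ζ) K(conj 2ζ)`. Taking opposite signs of `p` in the two integrals
  -- leaves only `exp (-p l)` after the shear `a = l + b`.
  set F₁ : ℝ → ℂ := fun a => Complex.exp (((-p : ℝ) : ℂ) * a - 2 * ζ * Complex.cosh a) with hF₁
  set F₂ : ℝ → ℂ := fun b => Complex.exp (p * b - (starRingEnd ℂ) (2 * ζ) * Complex.cosh b) with hF₂
  have hζre : 0 < (2 * ζ).re := by simp [hζ]; positivity
  have hF₁i : Integrable F₁ := integrable_exp_sub_mul_cosh (-p) hζre
  have hF₂i : Integrable F₂ := integrable_exp_sub_mul_cosh p (by rwa [Complex.conj_re])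
  have hmp := measurePreserving_add_prod (volume : Measure ℝ) (volume : Measure ℝ)
  have hFi : Integrable (fun z : ℝ × ℝ => F₁ (z.1 + z.2) * F₂ z.2) (volume.prod volume) :=
    hmp.integrable_comp_of_integrable (hF₁i.mul_prod hF₂i)
  have hinner : ∀ l, ∫ b, F₁ (l + b) * F₂ b = ((∫ y, E l y : ℝ) : ℂ) := by
    intro l
    have := integral_exp_conj (hAre l) l hs
    simp only [hE, hAn] at this ⊢
    rw [integral_const_mul, Complex.ofReal_mul, ← this, ← integral_const_mul]
    refine integral_congr_ae (ae_of_all _ fun b => ?_)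
    simp only [hF₁, hF₂, Complex.ofReal_exp]
    rw [← Complex.exp_add, ← Complex.exp_add, Complex.cosh, Complex.cosh]
    congr 1
    simp only [hA, map_add, map_mul, Complex.conj_conj, Complex.conj_ofReal, map_ofNat]
    push_cast
    have e1 : Complex.exp (-l) * Complex.exp l = 1 := by rw [← Complex.exp_add]; simp
    simp only [neg_add, Complex.exp_add]
    linear_combination ((starRingEnd ℂ) ζ * Complex.exp (-b)) * e1
  have hhi : Integrable fun l => ∫ y, E l y := by
    have := hFi.integral_prod_left
    simp only [hinner] at this
    simpa using this.re
  have htot : ((∫ l, ∫ y, E l y : ℝ) : ℂ) = ((‖2 * besselK p (2 * ζ)‖ ^ 2 : ℝ) : ℂ) := by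
    rw [← integral_complex_ofReal]
    simp only [← hinner]
    rw [← integral_prod _ hFi]
    have h3 := integral_map (f := fun z : ℝ × ℝ => F₁ z.1 * F₂ z.2) hmp.measurable.aemeasurable
      (by rw [hmp.map_eq]; exact (hF₁i.mul_prod hF₂i).aestronglyMeasurable)
    rw [hmp.map_eq] at h3
    rw [← h3, integral_prod_mul]
    have k1 : ∫ a, F₁ a = 2 * besselK p (2 * ζ) := by
      rw [two_mul_besselK]; simp only [hF₁, Complex.ofReal_neg]
    have k2 : ∫ b, F₂ b = (starRingEnd ℂ) (2 * besselK p (2 * ζ)) := by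
      rw [map_mul, ← besselK_conj, map_ofNat, two_mul_besselK']
    rw [k1, k2, Complex.mul_conj, Complex.normSq_eq_norm_sq]
  rw [step1]
  simp only [step2]
  rw [← ofReal_integral_eq_lintegral_ofReal hhi (ae_of_all _ fun l => integral_nonneg fun y => by
    simp only [hE, Pi.zero_apply]; positivity)]
  rw [Complex.ofReal_inj.1 htot]

/-! ### The boundary value of the Macdonald function at angle `π/2` -/

lemma exp_I_mul_cosh_sub (α t : ℝ) :
    Complex.exp (α * Complex.I) * Complex.cosh (t + (-α : ℝ) * Complex.I) =
      (Complex.exp t + Complex.exp ((2 * α : ℝ) * Complex.I) * Complex.exp (-t)) / 2 := by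
  rw [Complex.cosh, mul_div_assoc', mul_add, ← Complex.exp_add, ← Complex.exp_add,
    ← Complex.exp_add]
  congr 3 <;> push_cast <;> ring_nf

/-- On the strip between heights `-α` and `0` the growing exponential has coefficient `cos (α + φ) ≥
cos α > 0`, and the other one costs at most a factor `exp (x / 2)`. The vertical side of the
half-strip gives the finite integral. -/
lemma integral_Ioi_rotate {x α : ℝ} (hx : 0 < x) (hα0 : 0 ≤ α) (hα : α < π / 2) (ν : ℝ) :
    ∫ t in Set.Ioi (0 : ℝ),
        Complex.exp (ν * t - x * Complex.exp (α * Complex.I) * Complex.cosh t) =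
      (∫ t in Set.Ioi (0 : ℝ), Complex.exp (ν * (t + (-α : ℝ) * Complex.I)
        - x * Complex.exp (α * Complex.I) * Complex.cosh (t + (-α : ℝ) * Complex.I))) +
      Complex.I * ∫ y in (0 : ℝ)..(-α), Complex.exp (ν * (y * Complex.I)
        - x * Complex.exp (α * Complex.I) * Complex.cosh (y * Complex.I)) := by
  have hcos : 0 < cos α := cos_pos_of_mem_Ioo ⟨by linarith [pi_pos], hα⟩
  have hk : 0 < x * cos α / 2 := by positivity
  have := integral_Ioi_sub_integral_Ioi_of_le_exp
    (f := fun z => Complex.exp (ν * z - x * Complex.exp (α * Complex.I) * Complex.cosh z))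
    (by fun_prop) (a := 0) (b := -α)
    (C := exp (x / 2) * exp ((ν + 1) ^ 2 / (2 * (x * cos α / 2)))) (fun t ht φ hφ => by
      rw [mul_assoc (exp (x / 2))]
      refine le_trans ?_ (mul_le_mul_of_nonneg_left (exp_sub_mul_exp_le ν hk ht) (exp_pos _).le)
      rw [← exp_add, Complex.norm_exp]
      apply exp_le_exp.2
      have hre : (ν * (t + φ * Complex.I) - x * Complex.exp (α * Complex.I) *
          Complex.cosh (t + φ * Complex.I) : ℂ).re =
          ν * t - x / 2 * (exp t * cos (α + φ) + exp (-t) * cos (α - φ)) := by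
        have : (x * Complex.exp (α * Complex.I) * Complex.cosh (t + φ * Complex.I) : ℂ) =
          (x / 2 : ℝ) * (Complex.exp (t + (α + φ : ℝ) * Complex.I) +
            Complex.exp (((-t : ℝ) : ℂ) + (α - φ : ℝ) * Complex.I)) := by
          have e1 : Complex.exp (t + (α + φ : ℝ) * Complex.I) =
            Complex.exp (α * Complex.I) * Complex.exp (t + φ * Complex.I) := by
              rw [← Complex.exp_add]; congr 1; push_cast; ring
          have e2 : Complex.exp (((-t : ℝ) : ℂ) + (α - φ : ℝ) * Complex.I) =
            Complex.exp (α * Complex.I) * Complex.exp (-(t + φ * Complex.I)) := by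
              rw [← Complex.exp_add]; congr 1; push_cast; ring
          rw [e1, e2, Complex.cosh]; push_cast; ring
        have h1 : (ν * (t + φ * Complex.I) : ℂ).re = ν * t := by simp
        have h2 : ∀ r ψ : ℝ, (Complex.exp (r + ψ * Complex.I)).re = exp r * cos ψ := by
          intro r ψ; simp [Complex.exp_re]
        rw [Complex.sub_re, this, h1, Complex.re_ofReal_mul, Complex.add_re, h2, h2]
      rw [hre]
      rw [Set.mem_uIcc] at hφ
      have hφ' : -α ≤ φ ∧ φ ≤ 0 := by
        rcases hφ with h | h
        · constructor <;> linarith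
        · exact h
      have h1 : cos α ≤ cos (α + φ) :=
        cos_le_cos_of_nonneg_of_le_pi (by linarith) (by linarith [pi_pos]) (by linarith)
      have h2 : -1 ≤ exp (-t) * cos (α - φ) := by
        have h3 : exp (-t) ≤ 1 := exp_le_one_iff.2 (by linarith)
        nlinarith [neg_one_le_cos (α - φ), exp_pos (-t)]
      have h4 := mul_le_mul_of_nonneg_left h1 (exp_pos t).le
      have h5 : x / 2 * (exp t * cos α - 1) ≤
          x / 2 * (exp t * cos (α + φ) + exp (-t) * cos (α - φ)) :=
        mul_le_mul_of_nonneg_left (by linarith) (by positivity)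
      linarith)
  simp only [Complex.ofReal_zero, zero_mul, add_zero] at this
  rw [← this]; ring

/-- Half of the Macdonald integral on a rotated contour, which makes sense for every angle. -/
noncomputable def rotatedHalf (ν x α : ℝ) : ℂ :=
  (∫ t in Set.Ioi (0 : ℝ), Complex.exp (ν * (t + (-α : ℝ) * Complex.I)
        - x * Complex.exp (α * Complex.I) * Complex.cosh (t + (-α : ℝ) * Complex.I))) +
      Complex.I * ∫ y in (0 : ℝ)..(-α), Complex.exp (ν * (y * Complex.I)
        - x * Complex.exp (α * Complex.I) * Complex.cosh (y * Complex.I))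

/-- On the rotated contour the coefficient of `exp t` is the positive real `x / 2` whatever `α` is,
so the bound is uniform in the angle. This is what lets `α` reach `π/2`. -/
lemma norm_rotated_le {x : ℝ} (hx : 0 < x) (ν α : ℝ) {t : ℝ} (ht : 0 ≤ t) :
    ‖Complex.exp (ν * (t + (-α : ℝ) * Complex.I)
        - x * Complex.exp (α * Complex.I) * Complex.cosh (t + (-α : ℝ) * Complex.I))‖ ≤
      exp (x / 2) * exp ((ν + 1) ^ 2 / (2 * (x / 2))) * exp (-t) := by
  rw [mul_assoc (exp (x / 2))]
  refine le_trans ?_ (mul_le_mul_of_nonneg_left (exp_sub_mul_exp_le ν (half_pos hx) ht)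
    (exp_pos _).le)
  rw [← exp_add, Complex.norm_exp]
  apply exp_le_exp.2
  rw [mul_assoc, exp_I_mul_cosh_sub]
  have hre : (ν * (t + (-α : ℝ) * Complex.I) - x * ((Complex.exp t +
      Complex.exp ((2 * α : ℝ) * Complex.I) * Complex.exp (-t)) / 2) : ℂ).re =
      ν * t - x / 2 * (exp t + cos (2 * α) * exp (-t)) := by
    have : (x * ((Complex.exp t +
      Complex.exp ((2 * α : ℝ) * Complex.I) * Complex.exp (-t)) / 2) : ℂ) =
      (x / 2 : ℝ) * (((exp t : ℝ) : ℂ) + Complex.exp ((2 * α : ℝ) * Complex.I) *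
        ((exp (-t) : ℝ) : ℂ)) := by push_cast; ring
    have h1 : (ν * (t + (-α : ℝ) * Complex.I) : ℂ).re = ν * t := by simp
    rw [Complex.sub_re, this, h1, Complex.re_ofReal_mul, Complex.add_re, Complex.re_mul_ofReal,
      Complex.exp_ofReal_mul_I_re, Complex.ofReal_re]
  rw [hre]
  have h2 : -1 ≤ cos (2 * α) * exp (-t) := by
    have h3 : exp (-t) ≤ 1 := exp_le_one_iff.2 (by linarith)
    nlinarith [neg_one_le_cos (2 * α), exp_pos (-t)]
  have h5 : x / 2 * (exp t - 1) ≤ x / 2 * (exp t + cos (2 * α) * exp (-t)) :=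
    mul_le_mul_of_nonneg_left (by linarith) (by positivity)
  linarith

lemma continuous_rotatedHalf {x : ℝ} (hx : 0 < x) (ν : ℝ) : Continuous (rotatedHalf ν x) := by
  unfold rotatedHalf
  refine Continuous.add ?_ (continuous_const.mul ?_)
  · refine continuous_of_dominated (bound := fun t =>
      exp (x / 2) * exp ((ν + 1) ^ 2 / (2 * (x / 2))) * exp (-t)) (fun α => ?_) (fun α => ?_) ?_ ?_
    · exact Continuous.aestronglyMeasurable (by fun_prop)
    · filter_upwards [ae_restrict_mem measurableSet_Ioi] with t ht
      exact norm_rotated_le hx ν α (le_of_lt ht)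
    · exact (integrableOn_exp_neg_Ioi 0).const_mul _
    · exact ae_of_all _ fun t => by fun_prop
  · refine intervalIntegral.continuous_parametric_intervalIntegral_of_continuous
      (f := fun α y : ℝ => Complex.exp (ν * (y * Complex.I)
        - x * Complex.exp (α * Complex.I) * Complex.cosh (y * Complex.I))) ?_ continuous_neg
    simp only [Function.uncurry_def]
    fun_prop

lemma two_mul_besselK_eq_rotatedHalf {x α : ℝ} (hx : 0 < x) (hα0 : 0 ≤ α) (hα : α < π / 2)
    (ν : ℝ) : 2 * besselK ν (x * Complex.exp (α * Complex.I)) =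
      rotatedHalf ν x α + rotatedHalf (-ν) x α := by
  have hcos : 0 < cos α := cos_pos_of_mem_Ioo ⟨by linarith [pi_pos], hα⟩
  have hz : 0 < (x * Complex.exp (α * Complex.I) : ℂ).re := by
    rw [Complex.re_ofReal_mul, Complex.exp_ofReal_mul_I_re]; positivity
  rw [two_mul_besselK', integral_eq_integral_Ioi_add (integrable_exp_sub_mul_cosh ν hz)]
  unfold rotatedHalf
  rw [← integral_Ioi_rotate hx hα0 hα, ← integral_Ioi_rotate hx hα0 hα]
  congr 1
  refine integral_congr_ae (ae_of_all _ fun t => ?_)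
  simp

lemma integrableOn_exp_sub_sinh {x : ℝ} (hx : 0 < x) (ν : ℝ) :
    IntegrableOn (fun t : ℝ => exp (ν * t - x * sinh t)) (Set.Ioi 0) := by
  refine ((integrableOn_exp_neg_Ioi 0).const_mul
    (exp (x / 2) * exp ((ν + 1) ^ 2 / (2 * (x / 2))))).mono'
    (Continuous.aestronglyMeasurable (by fun_prop)) ?_
  filter_upwards [ae_restrict_mem measurableSet_Ioi] with t ht
  have ht' : 0 ≤ t := le_of_lt ht
  rw [norm_of_nonneg (exp_pos _).le, mul_assoc (exp (x / 2))]
  refine le_trans ?_ (mul_le_mul_of_nonneg_left (exp_sub_mul_exp_le ν (half_pos hx) ht')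
    (exp_pos _).le)
  rw [← exp_add]
  apply exp_le_exp.2
  have h3 : exp (-t) ≤ 1 := exp_le_one_iff.2 (by linarith)
  rw [sinh_eq]
  nlinarith

lemma rotated_pi_div_two (ν x t : ℝ) :
    Complex.exp (ν * (t + (-(π / 2) : ℝ) * Complex.I)
        - x * Complex.exp ((π / 2 : ℝ) * Complex.I) *
          Complex.cosh (t + (-(π / 2) : ℝ) * Complex.I)) =
      Complex.exp (-(ν * (π / 2)) * Complex.I) * ((exp (ν * t - x * sinh t) : ℝ) : ℂ) := by
  have h : Complex.exp ((2 * (π / 2) : ℝ) * Complex.I) = -1 := by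
    rw [mul_div_cancel₀ _ two_ne_zero, Complex.exp_pi_mul_I]
  rw [mul_assoc, exp_I_mul_cosh_sub, h, Complex.ofReal_exp, ← Complex.exp_add]
  congr 1
  push_cast
  rw [Complex.sinh]
  ring

/-- By evenness of `cosh` the segments for `ν` and `-ν` join into one over `[-π/2, π/2]`.
Translating by `π/2` turns the cosine into a sine and gives the finite part of Schläfli's integrals.
-/
lemma integral_cosh_I_add (ν x : ℝ) :
    (∫ y in (0 : ℝ)..(-(π / 2)), Complex.exp (ν * (y * Complex.I)
        - x * Complex.exp ((π / 2 : ℝ) * Complex.I) * Complex.cosh (y * Complex.I))) +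
      (∫ y in (0 : ℝ)..(-(π / 2)), Complex.exp ((-ν : ℝ) * (y * Complex.I)
        - x * Complex.exp ((π / 2 : ℝ) * Complex.I) * Complex.cosh (y * Complex.I))) =
      - (Complex.exp (-(ν * (π / 2)) * Complex.I) *
        ∫ θ in (0 : ℝ)..π, Complex.exp ((ν * θ - x * sin θ : ℝ) * Complex.I)) := by
  set g : ℝ → ℂ := fun y => Complex.exp (ν * (y * Complex.I)
        - x * Complex.exp ((π / 2 : ℝ) * Complex.I) * Complex.cosh (y * Complex.I)) with hg
  have hgc : Continuous g := by fun_prop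
  have h2 : (∫ y in (0 : ℝ)..(-(π / 2)), Complex.exp ((-ν : ℝ) * (y * Complex.I)
        - x * Complex.exp ((π / 2 : ℝ) * Complex.I) * Complex.cosh (y * Complex.I))) =
        ∫ y in (π / 2)..0, g y := by
    have := intervalIntegral.integral_comp_neg (a := 0) (b := -(π / 2)) g
    rw [neg_neg, neg_zero] at this
    rw [← this]
    refine intervalIntegral.integral_congr fun y _ => ?_
    simp [hg]
  have h3 : ∫ y in (-(π / 2))..(π / 2), g y = Complex.exp (-(ν * (π / 2)) * Complex.I) *
        ∫ θ in (0 : ℝ)..π, Complex.exp ((ν * θ - x * sin θ : ℝ) * Complex.I) := by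
    have := intervalIntegral.integral_comp_sub_right (a := 0) (b := π) g (π / 2)
    rw [zero_sub, show π - π / 2 = π / 2 by ring] at this
    rw [← this, ← intervalIntegral.integral_const_mul]
    refine intervalIntegral.integral_congr fun θ _ => ?_
    simp only [hg]
    rw [← Complex.exp_add, Complex.cosh_mul_I]
    push_cast
    rw [Complex.cos_sub_pi_div_two, Complex.exp_pi_div_two_mul_I]
    congr 1
    ring
  rw [h2, add_comm, intervalIntegral.integral_add_adjacent_intervals
    (hgc.intervalIntegrable _ _) (hgc.intervalIntegrable _ _), intervalIntegral.integral_symm, h3]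

/-- The Hankel function on the positive half-line from Schläfli's integrals. -/
lemma rotatedHalf_pi_div_two {x : ℝ} (hx : 0 < x) (ν : ℝ) :
    rotatedHalf ν x (π / 2) + rotatedHalf (-ν) x (π / 2) =
      -Complex.I * Complex.exp (-(ν * (π / 2)) * Complex.I) *
        (π * (besselJ ν x - Complex.I * besselY ν x)) := by
  set P : ℝ := ∫ t in Set.Ioi (0 : ℝ), exp (ν * t - x * sinh t) with hP
  set M : ℝ := ∫ t in Set.Ioi (0 : ℝ), exp (-ν * t - x * sinh t) with hM
  set C : ℝ := ∫ θ in (0 : ℝ)..π, cos (ν * θ - x * sin θ) with hC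
  set S : ℝ := ∫ θ in (0 : ℝ)..π, sin (x * sin θ - ν * θ) with hS
  have hJ : π * besselJ ν x = C - sin (ν * π) * M := by
    have : ∫ t in Set.Ioi (0 : ℝ), exp (-x * sinh t - ν * t) = M := by
      rw [hM]; congr 1; ext t; congr 1; ring
    rw [besselJ, this, ← hC]; field_simp
  have hY : π * besselY ν x = S - (P + cos (ν * π) * M) := by
    have : ∫ t in Set.Ioi (0 : ℝ), (exp (ν * t) + exp (-ν * t) * cos (ν * π)) * exp (-x * sinh t) =
        P + cos (ν * π) * M := by
      rw [hP, hM, ← integral_const_mul, ← integral_add (integrableOn_exp_sub_sinh hx ν)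
        ((integrableOn_exp_sub_sinh hx (-ν)).const_mul _)]
      congr 1; ext t
      rw [sub_eq_add_neg, sub_eq_add_neg, exp_add, exp_add, ← neg_mul]; ring
    rw [besselY, this, ← hS]; field_simp
  have hCS : ∫ θ in (0 : ℝ)..π, Complex.exp ((ν * θ - x * sin θ : ℝ) * Complex.I) =
      C - Complex.I * S := by
    have hi1 : IntervalIntegrable (fun θ : ℝ => ((cos (ν * θ - x * sin θ) : ℝ) : ℂ)) volume 0 π :=
      Continuous.intervalIntegrable (by fun_prop) _ _
    have hi2 : IntervalIntegrable (fun θ : ℝ => Complex.I * ((sin (x * sin θ - ν * θ) : ℝ) : ℂ))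
      volume 0 π := Continuous.intervalIntegrable (by fun_prop) _ _
    rw [hC, hS, ← intervalIntegral.integral_ofReal, ← intervalIntegral.integral_ofReal,
      ← intervalIntegral.integral_const_mul, ← intervalIntegral.integral_sub hi1 hi2]
    refine intervalIntegral.integral_congr fun θ _ => ?_
    rw [Complex.exp_mul_I, ← Complex.ofReal_cos, ← Complex.ofReal_sin,
      ← neg_sub (ν * θ), sin_neg]
    push_cast; ring
  have hA := integral_cosh_I_add ν x
  rw [hCS] at hA
  unfold rotatedHalf
  simp only [rotated_pi_div_two]
  rw [integral_const_mul, integral_const_mul, integral_complex_ofReal, integral_complex_ofReal,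
    ← hP, ← hM]
  have hprod : (π * (besselJ ν x - Complex.I * besselY ν x) : ℂ) =
      ((C - sin (ν * π) * M : ℝ) : ℂ) - Complex.I * ((S - (P + cos (ν * π) * M) : ℝ) : ℂ) := by
    rw [← hJ, ← hY]; push_cast; ring
  -- The ratio `e^{iνπ}` of the two phases supplies the coefficients `cos νπ` and `sin νπ` in `J`
  -- and `Y`.
  have hE : Complex.exp (-(((-ν : ℝ) : ℂ) * (π / 2)) * Complex.I) =
      Complex.exp (-(ν * (π / 2)) * Complex.I) *
        (((cos (ν * π) : ℝ) : ℂ) + ((sin (ν * π) : ℝ) : ℂ) * Complex.I) := by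
    rw [Complex.ofReal_cos, Complex.ofReal_sin, ← Complex.exp_mul_I, ← Complex.exp_add]
    congr 1; push_cast; ring
  rw [hprod, hE]
  push_cast at hA ⊢
  linear_combination Complex.I * hA + Complex.exp (-(ν * (π / 2)) * Complex.I) *
    (P + Complex.cos (ν * π) * M) * Complex.I_sq

lemma two_div_mul_exp_eq (s α : ℝ) :
    (2 * Complex.exp (Complex.I * α) / s : ℂ) = ((2 / s : ℝ) : ℂ) * Complex.exp (α * Complex.I) := by
  rw [mul_comm Complex.I]; push_cast; ring

/-- The rotated expression is continuous across `π/2`, where it is `π (J - iY)` up to a unimodular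
factor. -/
lemma tendsto_norm_besselK_sq {s : ℝ} (hs : 0 < s) (p : ℝ) :
    Tendsto (fun α : ℝ => ‖2 * besselK p (2 * Complex.exp (Complex.I * α) / s)‖ ^ 2)
      (𝓝[<] (π / 2)) (𝓝 (π ^ 2 * (besselJ p (2 / s) ^ 2 + besselY p (2 / s) ^ 2))) := by
  have hx : 0 < 2 / s := by positivity
  have hcont : Continuous fun α => ‖rotatedHalf p (2 / s) α + rotatedHalf (-p) (2 / s) α‖ ^ 2 :=
    ((continuous_rotatedHalf hx p).add (continuous_rotatedHalf hx (-p))).norm.pow 2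
  have hval : ‖rotatedHalf p (2 / s) (π / 2) + rotatedHalf (-p) (2 / s) (π / 2)‖ ^ 2 =
      π ^ 2 * (besselJ p (2 / s) ^ 2 + besselY p (2 / s) ^ 2) := by
    rw [rotatedHalf_pi_div_two hx, norm_mul, norm_mul, norm_mul, norm_neg, Complex.norm_I, one_mul]
    have h1 : ‖Complex.exp (-(p * (π / 2)) * Complex.I)‖ = 1 := by
      have := Complex.norm_exp_ofReal_mul_I (-(p * (π / 2)))
      push_cast at this; exact this
    rw [h1, one_mul, mul_pow, Complex.sq_norm, Complex.sq_norm, Complex.normSq_ofReal,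
      Complex.normSq_apply]
    simp
    ring
  have := (hcont.tendsto (π / 2)).mono_left (nhdsWithin_le_nhds (s := Set.Iio (π / 2)))
  rw [hval] at this
  refine this.congr' ?_
  filter_upwards [Ioo_mem_nhdsLT (show (0 : ℝ) < π / 2 by positivity)] with α hα
  rw [two_div_mul_exp_eq, two_mul_besselK_eq_rotatedHalf hx hα.1.le hα.2]

/-! ### Integrability of the weight and continuity in the angle -/

/-- Lebesgue measure on the open positive quadrant. -/
noncomputable abbrev quadrant : Measure (ℝ × ℝ) :=
  ((volume : Measure ℝ).restrict (Set.Ioi 0)).prod ((volume : Measure ℝ).restrict (Set.Ioi 0))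

lemma ae_quadrant : ∀ᵐ z ∂quadrant, 0 < z.1 ∧ 0 < z.2 := by
  rw [quadrant, Measure.prod_restrict]
  exact ae_restrict_mem (measurableSet_Ioi.prod measurableSet_Ioi)

instance : NeZero quadrant := by
  refine ⟨fun h => ?_⟩
  have := Measure.prod_prod (μ := (volume : Measure ℝ).restrict (Set.Ioi 0))
    (ν := (volume : Measure ℝ).restrict (Set.Ioi 0)) Set.univ Set.univ
  rw [show ((volume : Measure ℝ).restrict (Set.Ioi 0)).prod
    ((volume : Measure ℝ).restrict (Set.Ioi 0)) = 0 from h] at this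
  simp at this

lemma lintegral_quadrant {p s α : ℝ} (hs : 0 < s) (hα : |α| < π / 2) :
    ∫⁻ z, ENNReal.ofReal (coneWeight p s α z.1 z.2) ∂quadrant =
      ENNReal.ofReal (‖2 * besselK p (2 * Complex.exp (Complex.I * α) / s)‖ ^ 2) := by
  rw [← lintegral_coneWeight hs hα, quadrant, lintegral_prod_symm _ (by fun_prop)]

lemma coneWeight_neg (p s α u v : ℝ) : coneWeight p s (-α) u v = coneWeight p s α u v := by
  simp [coneWeight]

/-- The angle enters only through `cos 2α`, which is minimal at `π/2`. This is the dominating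
function used below. -/
lemma coneWeight_le {p s u v : ℝ} (α : ℝ) (hs : 0 < s) (hu : 0 < u) (hv : 0 < v) :
    coneWeight p s α u v ≤ coneWeight p s (π / 2) u v := by
  unfold coneWeight
  apply mul_le_mul_of_nonneg_left _ (by positivity)
  apply exp_le_exp.2
  rw [mul_div_cancel₀ _ two_ne_zero, cos_pi, neg_mul, neg_mul, neg_le_neg_iff]
  apply mul_le_mul_of_nonneg_left _ (by positivity)
  nlinarith [neg_one_le_cos (2 * α)]

lemma continuous_coneWeight (p s u v : ℝ) : Continuous fun α => coneWeight p s α u v := by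
  unfold coneWeight
  fun_prop

/-- Fatou along angles increasing to `π/2`. An inequality suffices here: it yields integrability,
and `coneMass_pi_div_two` then upgrades it to an equality. -/
lemma lintegral_quadrant_pi_div_two_le {s : ℝ} (p : ℝ) (hs : 0 < s) :
    ∫⁻ z, ENNReal.ofReal (coneWeight p s (π / 2) z.1 z.2) ∂quadrant ≤
      ENNReal.ofReal (π ^ 2 * (besselJ p (2 / s) ^ 2 + besselY p (2 / s) ^ 2)) := by
  obtain ⟨a, -, ha, hlim⟩ := exists_seq_strictMono_tendsto' (show (0 : ℝ) < π / 2 by positivity)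
  have h1 : Tendsto (fun n => ∫⁻ z, ENNReal.ofReal (coneWeight p s (a n) z.1 z.2) ∂quadrant) atTop
      (𝓝 (ENNReal.ofReal (π ^ 2 * (besselJ p (2 / s) ^ 2 + besselY p (2 / s) ^ 2)))) := by
    have h2 : Tendsto a atTop (𝓝[<] (π / 2)) :=
      tendsto_nhdsWithin_iff.2 ⟨hlim, Eventually.of_forall fun n => (ha n).2⟩
    have := (ENNReal.continuous_ofReal.tendsto _).comp ((tendsto_norm_besselK_sq hs p).comp h2)
    refine this.congr fun n => ?_
    rw [lintegral_quadrant hs (abs_lt.2 ⟨by linarith [(ha n).1, pi_pos], (ha n).2⟩)]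
    rfl
  rw [← h1.liminf_eq]
  refine le_trans (le_of_eq ?_) (lintegral_liminf_le fun n => by fun_prop)
  refine lintegral_congr fun z => ?_
  have : Tendsto (fun n => ENNReal.ofReal (coneWeight p s (a n) z.1 z.2)) atTop
      (𝓝 (ENNReal.ofReal (coneWeight p s (π / 2) z.1 z.2))) :=
    ((ENNReal.continuous_ofReal.comp (continuous_coneWeight p s z.1 z.2)).tendsto _).comp hlim
  exact this.liminf_eq.symm

lemma integrable_coneWeight {s : ℝ} (p α : ℝ) (hs : 0 < s) :
    Integrable (fun z : ℝ × ℝ => coneWeight p s α z.1 z.2) quadrant := by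
  have h : Integrable (fun z : ℝ × ℝ => coneWeight p s (π / 2) z.1 z.2) quadrant := by
    refine ⟨(measurable_coneWeight p s _).aestronglyMeasurable, ?_⟩
    rw [hasFiniteIntegral_iff_ofReal (by
      filter_upwards [ae_quadrant] with z hz using (coneWeight_pos p s _ hz.1 hz.2).le)]
    exact (lintegral_quadrant_pi_div_two_le p hs).trans_lt ENNReal.ofReal_lt_top
  refine h.mono' (measurable_coneWeight p s _).aestronglyMeasurable ?_
  filter_upwards [ae_quadrant] with z hz
  rw [norm_of_nonneg (coneWeight_pos p s _ hz.1 hz.2).le]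
  exact coneWeight_le α hs hz.1 hz.2

/-- Total mass of `coneWeight`. -/
noncomputable def coneMass (p s α : ℝ) : ℝ := ∫ z, coneWeight p s α z.1 z.2 ∂quadrant

lemma coneMass_pos {s : ℝ} (p α : ℝ) (hs : 0 < s) : 0 < coneMass p s α := by
  have h0 : 0 ≤ᵐ[quadrant] fun z : ℝ × ℝ => coneWeight p s α z.1 z.2 := by
    filter_upwards [ae_quadrant] with z hz using (coneWeight_pos p s _ hz.1 hz.2).le
  rw [coneMass, integral_pos_iff_support_of_nonneg_ae h0 (integrable_coneWeight p α hs)]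
  have : (Function.support fun z : ℝ × ℝ => coneWeight p s α z.1 z.2) =ᵐ[quadrant] Set.univ := by
    filter_upwards [ae_quadrant] with z hz
    exact eq_true (coneWeight_pos p s α hz.1 hz.2).ne'
  rw [measure_congr this]
  exact pos_iff_ne_zero.2 (Measure.measure_univ_ne_zero.2 (NeZero.ne quadrant))

lemma coneMass_neg (p s α : ℝ) : coneMass p s (-α) = coneMass p s α := by
  simp only [coneMass, coneWeight_neg]

lemma ofReal_coneMass {s : ℝ} (p α : ℝ) (hs : 0 < s) :
    ENNReal.ofReal (coneMass p s α) =
      ∫⁻ z, ENNReal.ofReal (coneWeight p s α z.1 z.2) ∂quadrant :=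
  ofReal_integral_eq_lintegral_ofReal (integrable_coneWeight p α hs) (by
    filter_upwards [ae_quadrant] with z hz using (coneWeight_pos p s _ hz.1 hz.2).le)

lemma coneMass_eq {p s α : ℝ} (hs : 0 < s) (hα : |α| < π / 2) :
    coneMass p s α = ‖2 * besselK p (2 * Complex.exp (Complex.I * α) / s)‖ ^ 2 := by
  have := ofReal_coneMass p α hs
  rw [lintegral_quadrant hs hα] at this
  exact (ENNReal.ofReal_eq_ofReal_iff (coneMass_pos p α hs).le (by positivity)).1 this

/-- The map `(u, v) ↦ u e^{iα} + v e^{-iα}`. -/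
noncomputable def coneMap (α : ℝ) (z : ℝ × ℝ) : ℂ :=
  z.1 * Complex.exp (α * Complex.I) + z.2 * Complex.exp (-α * Complex.I)

@[fun_prop]
lemma continuous_coneMap (α : ℝ) : Continuous (coneMap α) := by
  unfold coneMap
  fun_prop

lemma continuous_integral_mul_coneWeight {s : ℝ} (p : ℝ) (hs : 0 < s)
    (g : BoundedContinuousFunction ℂ ℝ) :
    Continuous fun α => ∫ z, coneWeight p s α z.1 z.2 * g (coneMap α z) ∂quadrant := by
  refine continuous_of_dominated (bound := fun z => coneWeight p s (π / 2) z.1 z.2 * ‖g‖)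
    (fun α => ?_) (fun α => ?_) ?_ ?_
  · exact ((measurable_coneWeight p s α).mul
      (g.continuous.comp (continuous_coneMap α)).measurable).aestronglyMeasurable
  · filter_upwards [ae_quadrant] with z hz
    rw [norm_mul, norm_of_nonneg (coneWeight_pos p s _ hz.1 hz.2).le]
    exact mul_le_mul (coneWeight_le α hs hz.1 hz.2) (g.norm_coe_le_norm _) (norm_nonneg _)
      (coneWeight_pos p s _ hz.1 hz.2).le
  · exact (integrable_coneWeight p _ hs).mul_const _
  · refine ae_of_all _ fun z => (continuous_coneWeight p s z.1 z.2).mul (g.continuous.comp ?_)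
    unfold coneMap
    fun_prop

lemma continuous_coneMass {s : ℝ} (p : ℝ) (hs : 0 < s) : Continuous (coneMass p s) := by
  have := continuous_integral_mul_coneWeight p hs (BoundedContinuousFunction.const ℂ 1)
  simp only [BoundedContinuousFunction.const_apply, mul_one] at this
  exact this

/-- The mass is continuous and agrees with `|2K|²` below `π/2`, so its value at `π/2` is the limit
already computed. -/
lemma coneMass_pi_div_two {s : ℝ} (p : ℝ) (hs : 0 < s) :
    coneMass p s (π / 2) = π ^ 2 * (besselJ p (2 / s) ^ 2 + besselY p (2 / s) ^ 2) := by
  have h1 := ((continuous_coneMass p hs).tendsto (π / 2)).mono_left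
    (nhdsWithin_le_nhds (s := Set.Iio (π / 2)))
  refine tendsto_nhds_unique h1 ((tendsto_norm_besselK_sq hs p).congr' ?_)
  filter_upwards [Ioo_mem_nhdsLT (show (0 : ℝ) < π / 2 by positivity)] with α hα
  rw [coneMass_eq hs (abs_lt.2 ⟨by linarith [hα.1, pi_pos], hα.2⟩)]

lemma normConst_eq {p s α : ℝ} (hs : 0 < s) (hα : |α| < π / 2) :
    normConst p s α = (coneMass p s α)⁻¹ := by
  rw [normConst, coneMass_eq hs hα, one_div]

lemma normConstPiHalf_eq {s : ℝ} (p : ℝ) (hs : 0 < s) :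
    normConstPiHalf p s = (coneMass p s (π / 2))⁻¹ := by
  rw [normConstPiHalf, coneMass_pi_div_two p hs, one_div]

/-- The law of `u e^{iα} + v e^{-iα}` when `(u, v)` has density proportional to `coneWeight`. -/
noncomputable def coneLaw (p s α : ℝ) : Measure ℂ :=
  (quadrant.withDensity fun z =>
    ENNReal.ofReal ((coneMass p s α)⁻¹ * coneWeight p s α z.1 z.2)).map (coneMap α)

lemma lintegral_coneLaw (p s α : ℝ) {g : ℂ → ENNReal} (hg : Measurable g) :
    ∫⁻ z, g z ∂coneLaw p s α = ∫⁻ z,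
      ENNReal.ofReal ((coneMass p s α)⁻¹ * coneWeight p s α z.1 z.2) * g (coneMap α z) ∂quadrant := by
  rw [coneLaw, lintegral_map hg (continuous_coneMap α).measurable,
    lintegral_withDensity_eq_lintegral_mul _ (by fun_prop)
      (show Measurable fun z => g (coneMap α z) from hg.comp (continuous_coneMap α).measurable)]
  rfl

lemma isProbabilityMeasure_coneLaw {s : ℝ} (p α : ℝ) (hs : 0 < s) :
    IsProbabilityMeasure (coneLaw p s α) := by
  constructor
  have h0 := coneMass_pos p α hs
  have := lintegral_coneLaw p s α (g := fun _ => 1) measurable_const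
  simp only [lintegral_one, mul_one, ENNReal.ofReal_mul (inv_nonneg.2 h0.le)] at this
  rw [this, lintegral_const_mul _ (by fun_prop), ← ofReal_coneMass p α hs,
    ← ENNReal.ofReal_mul (inv_nonneg.2 h0.le), inv_mul_cancel₀ h0.ne', ENNReal.ofReal_one]

lemma integral_coneLaw {s : ℝ} (p α : ℝ) (hs : 0 < s) (g : BoundedContinuousFunction ℂ ℝ) :
    ∫ z, g z ∂coneLaw p s α =
      (coneMass p s α)⁻¹ * ∫ z, coneWeight p s α z.1 z.2 * g (coneMap α z) ∂quadrant := by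
  rw [coneLaw, integral_map (continuous_coneMap α).aemeasurable
    g.continuous.aestronglyMeasurable,
    integral_withDensity_eq_integral_toReal_smul (by fun_prop)
      (ae_of_all _ fun _ => ENNReal.ofReal_lt_top), ← integral_const_mul]
  refine integral_congr_ae ?_
  filter_upwards [ae_quadrant] with z hz
  rw [ENNReal.toReal_ofReal (mul_nonneg (inv_nonneg.2 (coneMass_pos p α hs).le)
    (coneWeight_pos p s _ hz.1 hz.2).le), smul_eq_mul, mul_assoc]

/-- The laws depend continuously on the angle. -/
lemma continuous_coneLaw {s : ℝ} (p : ℝ) (hs : 0 < s) :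
    Continuous (Y := ProbabilityMeasure ℂ)
      fun α => ⟨coneLaw p s α, isProbabilityMeasure_coneLaw p α hs⟩ := by
  refine continuous_iff_continuousAt.2 fun α₀ => ?_
  refine ProbabilityMeasure.tendsto_iff_forall_integral_tendsto.2 fun g => ?_
  simp only [ProbabilityMeasure.coe_mk, integral_coneLaw p _ hs]
  exact (((continuous_coneMass p hs).inv₀ fun α => (coneMass_pos p α hs).ne').mul
    (continuous_integral_mul_coneWeight p hs g)).tendsto α₀

/-! ### Cone coordinates for `0 < |α| < π/2` -/

lemma coneMap_re (α : ℝ) (z : ℝ × ℝ) : (coneMap α z).re = (z.1 + z.2) * cos α := by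
  rw [coneMap, ← Complex.ofReal_neg, Complex.add_re, Complex.re_ofReal_mul, Complex.re_ofReal_mul,
    Complex.exp_ofReal_mul_I_re, Complex.exp_ofReal_mul_I_re, cos_neg]
  ring

lemma coneMap_im (α : ℝ) (z : ℝ × ℝ) : (coneMap α z).im = (z.1 - z.2) * sin α := by
  rw [coneMap, ← Complex.ofReal_neg, Complex.add_im, Complex.im_ofReal_mul, Complex.im_ofReal_mul,
    Complex.exp_ofReal_mul_I_im, Complex.exp_ofReal_mul_I_im, sin_neg]
  ring

lemma norm_mul_sin_add_arg (α : ℝ) (z : ℝ × ℝ) :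
    ‖coneMap α z‖ * sin (α + (coneMap α z).arg) = z.1 * sin (2 * α) := by
  have h1 := Complex.norm_mul_cos_arg (coneMap α z)
  have h2 := Complex.norm_mul_sin_arg (coneMap α z)
  rw [coneMap_re] at h1
  rw [coneMap_im] at h2
  rw [sin_add, sin_two_mul]
  linear_combination sin α * h1 + cos α * h2

lemma norm_mul_sin_sub_arg (α : ℝ) (z : ℝ × ℝ) :
    ‖coneMap α z‖ * sin (α - (coneMap α z).arg) = z.2 * sin (2 * α) := by
  have h1 := Complex.norm_mul_cos_arg (coneMap α z)
  have h2 := Complex.norm_mul_sin_arg (coneMap α z)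
  rw [coneMap_re] at h1
  rw [coneMap_im] at h2
  rw [sin_sub, sin_two_mul]
  linear_combination sin α * h1 - cos α * h2

lemma norm_coneMap_sq (α : ℝ) (z : ℝ × ℝ) :
    ‖coneMap α z‖ ^ 2 = z.1 ^ 2 + z.2 ^ 2 + 2 * z.1 * z.2 * cos (2 * α) := by
  rw [Complex.sq_norm, Complex.normSq_apply, coneMap_re, coneMap_im, cos_two_mul']
  linear_combination (z.1 ^ 2 + z.2 ^ 2) * sin_sq_add_cos_sq α

lemma sin_two_mul_pos {α : ℝ} (h0 : 0 < α) (h : α < π / 2) : 0 < sin (2 * α) :=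
  sin_pos_of_pos_of_lt_pi (by linarith) (by linarith)

lemma sin_two_mul_abs {α : ℝ} (h : |α| < π / 2) : sin (2 * |α|) = |sin (2 * α)| := by
  rcases lt_trichotomy α 0 with h0 | h0 | h0
  · rw [abs_of_neg h0] at h ⊢
    have := sin_two_mul_pos (neg_pos.2 h0) h
    rw [mul_neg, sin_neg] at this ⊢
    rw [abs_of_neg (by linarith)]
  · simp [h0]
  · rw [abs_of_pos h0] at h ⊢
    rw [abs_of_pos (sin_two_mul_pos h0 h)]

lemma coneMap_mem_coneS {α : ℝ} (h0 : 0 < |α|) (h : |α| < π / 2) {z : ℝ × ℝ} (h1 : 0 < z.1)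
    (h2 : 0 < z.2) : coneMap α z ∈ coneS α := by
  have e1 := norm_mul_sin_add_arg α z
  have e2 := norm_mul_sin_sub_arg α z
  have hn := norm_nonneg (coneMap α z)
  have hl := Complex.neg_pi_lt_arg (coneMap α z)
  have hu := Complex.arg_le_pi (coneMap α z)
  set θ := (coneMap α z).arg with hθ
  rw [coneS, Set.mem_ofPred_eq, ← hθ, abs_le]
  rcases abs_cases α with ⟨ha, _⟩ | ⟨ha, _⟩ <;> rw [ha] at h0 h ⊢
  · have hs := sin_two_mul_pos h0 h
    have p1 : 0 < sin (α + θ) := pos_of_mul_pos_right (e1 ▸ mul_pos h1 hs) hn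
    have p2 : 0 < sin (α - θ) := pos_of_mul_pos_right (e2 ▸ mul_pos h2 hs) hn
    constructor <;> by_contra! hc
    · exact absurd (sin_neg_of_neg_of_neg_pi_lt (x := α + θ) (by linarith) (by linarith)) p1.not_gt
    · exact absurd (sin_neg_of_neg_of_neg_pi_lt (x := α - θ) (by linarith) (by linarith)) p2.not_gt
  · have hs := sin_two_mul_pos h0 h
    rw [mul_neg, sin_neg] at hs
    have p1 : 0 < -sin (α + θ) := pos_of_mul_pos_right (a := ‖coneMap α z‖)
      (by rw [mul_neg, e1]; nlinarith) hn
    have p2 : 0 < -sin (α - θ) := pos_of_mul_pos_right (a := ‖coneMap α z‖)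
      (by rw [mul_neg, e2]; nlinarith) hn
    constructor <;> by_contra! hc
    · have := sin_pos_of_pos_of_lt_pi (x := α - θ) (by linarith) (by linarith)
      linarith
    · have := sin_pos_of_pos_of_lt_pi (x := α + θ) (by linarith) (by linarith)
      linarith

lemma nonneg_of_coneMap_mem_coneS {α : ℝ} (h0 : 0 < |α|) (h : |α| < π / 2) {z : ℝ × ℝ}
    (hz : coneMap α z ∈ coneS α) : 0 ≤ z.1 ∧ 0 ≤ z.2 := by
  have e1 := norm_mul_sin_add_arg α z
  have e2 := norm_mul_sin_sub_arg α z
  have hn := norm_nonneg (coneMap α z)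
  rw [coneS, Set.mem_ofPred_eq, abs_le] at hz
  set θ := (coneMap α z).arg with hθ
  rcases abs_cases α with ⟨ha, _⟩ | ⟨ha, _⟩ <;> rw [ha] at h0 h hz
  · have hs := sin_two_mul_pos h0 h
    have p1 : 0 ≤ sin (α + θ) := sin_nonneg_of_nonneg_of_le_pi (by linarith) (by linarith)
    have p2 : 0 ≤ sin (α - θ) := sin_nonneg_of_nonneg_of_le_pi (by linarith) (by linarith)
    exact ⟨nonneg_of_mul_nonneg_left (e1 ▸ mul_nonneg hn p1) hs,
      nonneg_of_mul_nonneg_left (e2 ▸ mul_nonneg hn p2) hs⟩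
  · have hs := sin_two_mul_pos h0 h
    rw [mul_neg, sin_neg] at hs
    have p1 : sin (α + θ) ≤ 0 := sin_nonpos_of_nonpos_of_neg_pi_le (by linarith) (by linarith)
    have p2 : sin (α - θ) ≤ 0 := sin_nonpos_of_nonpos_of_neg_pi_le (by linarith) (by linarith)
    have q1 := mul_nonpos_of_nonneg_of_nonpos hn p1
    have q2 := mul_nonpos_of_nonneg_of_nonpos hn p2
    constructor <;> nlinarith

/-- The factor `|sin 2α|` is the Jacobian of `coneMap α`. The two sines in the density are `u` and
`v` times the common factor `sin 2α / r`, so their ratio is `v / u`. -/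
lemma densityAlpha_coneMap {p s α : ℝ} (hs : 0 < s) (h0 : 0 < |α|) (h : |α| < π / 2) {z : ℝ × ℝ}
    (h1 : 0 < z.1) (h2 : 0 < z.2) :
    |sin (2 * α)| * densityAlpha p s α (coneMap α z) =
      (coneMass p s α)⁻¹ * coneWeight p s α z.1 z.2 := by
  rw [densityAlpha, Set.indicator_of_mem (coneMap_mem_coneS h0 h h1 h2), ← normConst_eq hs h]
  simp only
  have e1 := norm_mul_sin_add_arg α z
  have e2 := norm_mul_sin_sub_arg α z
  have e3 := norm_coneMap_sq α z
  have hS : sin (2 * α) ≠ 0 := by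
    rw [← abs_pos, ← sin_two_mul_abs h]
    exact sin_two_mul_pos h0 h
  rw [sin_two_mul_abs h]
  have hr : ‖coneMap α z‖ ≠ 0 := by
    intro hr; rw [hr, zero_mul] at e1
    exact mul_ne_zero h1.ne' hS e1.symm
  set r := ‖coneMap α z‖
  set a := sin (α + (coneMap α z).arg)
  set b := sin (α - (coneMap α z).arg)
  set S := sin (2 * α)
  have ha : a = z.1 * S / r := by rw [eq_div_iff hr, mul_comm, e1]
  have hb : b = z.2 * S / r := by rw [eq_div_iff hr, mul_comm, e2]
  have f1 : b / a = z.2 / z.1 := by rw [ha, hb]; field_simp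
  have f2 : |S| * (|S| * (1 / (r ^ 2 * a ^ 2))) = z.1 ^ (-2 : ℝ) := by
    rw [rpow_neg h1.le, rpow_two, ha]; field_simp; exact sq_abs S
  have f3 : S / s * (1 / (r * b) + r / a) =
      1 / s * (1 / z.2 + z.1 + z.2 ^ 2 / z.1 + 2 * z.2 * cos (2 * α)) := by
    have : r / a = r ^ 2 / (z.1 * S) := by rw [ha]; field_simp
    rw [this, e3, e2]; field_simp; ring
  rw [f1, neg_mul, f3, coneWeight, div_rpow h2.le h1.le,
    show -p - 1 = -2 - (p - 1) by ring, rpow_sub h1 (-2) (p - 1), ← f2, neg_mul]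
  ring

lemma map_coneMap_volume {α : ℝ} (hS : sin (2 * α) ≠ 0) :
    (volume : Measure (ℝ × ℝ)).map (coneMap α) =
      ENNReal.ofReal |(sin (2 * α))⁻¹| • (volume : Measure ℂ) := by
  set L : ℝ × ℝ →ₗ[ℝ] ℝ × ℝ := Matrix.toLin (Module.Basis.finTwoProd ℝ) (Module.Basis.finTwoProd ℝ)
    !![cos α, cos α; sin α, -sin α] with hL
  have hdet : LinearMap.det L = -sin (2 * α) := by
    rw [hL, LinearMap.det_toLin, Matrix.det_fin_two_of, sin_two_mul]; ring
  have hmap := Measure.map_linearMap_addHaar_eq_smul_addHaar (volume : Measure (ℝ × ℝ))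
    (f := L) (by rw [hdet]; exact neg_ne_zero.2 hS)
  have hcomp : coneMap α = Complex.measurableEquivRealProd.symm ∘ L := by
    funext z
    apply Complex.ext
    · simp only [coneMap_re, Function.comp_apply, hL, Matrix.toLin_finTwoProd_apply,
        Complex.measurableEquivRealProd_symm_apply]
      ring
    · simp only [coneMap_im, Function.comp_apply, hL, Matrix.toLin_finTwoProd_apply,
        Complex.measurableEquivRealProd_symm_apply]
      ring
  have hLm : Measurable L := L.continuous_of_finiteDimensional.measurable
  rw [hcomp, ← Measure.map_map Complex.measurableEquivRealProd.symm.measurable hLm, hmap, hdet,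
    Measure.map_smul, Complex.volume_preserving_equiv_real_prod.symm.map_eq, inv_neg, abs_neg]

lemma measurable_densityAlpha (p s α : ℝ) : Measurable (densityAlpha p s α) := by
  unfold densityAlpha
  refine Measurable.indicator ?_ ?_
  · have := Complex.measurable_arg
    fun_prop
  · exact measurableSet_le (by have := Complex.measurable_arg; fun_prop) measurable_const

lemma nuAlpha_eq_coneLaw {s α : ℝ} (p : ℝ) (hs : 0 < s) (h0 : 0 < |α|) (h : |α| < π / 2) :
    nuAlpha p s α = coneLaw p s α := by
  have hS : 0 < |sin (2 * α)| := by
    rw [← sin_two_mul_abs h]; exact sin_two_mul_pos h0 h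
  have hd := measurable_densityAlpha p s α
  refine Measure.ext_of_lintegral _ fun g hg => ?_
  rw [lintegral_coneLaw p s α hg, nuAlpha,
    lintegral_withDensity_eq_lintegral_mul _ (by fun_prop) hg]
  have hvol : (volume : Measure ℂ) =
      ENNReal.ofReal |sin (2 * α)| • (volume : Measure (ℝ × ℝ)).map (coneMap α) := by
    rw [map_coneMap_volume (abs_pos.1 hS), smul_smul, ← ENNReal.ofReal_mul hS.le, abs_inv,
      mul_inv_cancel₀ hS.ne', ENNReal.ofReal_one, one_smul]
  have hcm := (continuous_coneMap α).measurable
  rw [hvol, lintegral_smul_measure, lintegral_map (by fun_prop) hcm, smul_eq_mul,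
    ← lintegral_const_mul _ (by fun_prop), quadrant, Measure.prod_restrict,
    ← lintegral_indicator (measurableSet_Ioi.prod measurableSet_Ioi)]
  refine lintegral_congr_ae ?_
  -- The closed cone corresponds to the closed quadrant, which differs from the open one by the null
  -- coordinate axes.
  have hne : ∀ᵐ x : ℝ, x ≠ 0 := compl_mem_ae_iff.2 (measure_singleton 0)
  filter_upwards [Measure.quasiMeasurePreserving_fst.ae hne,
    Measure.quasiMeasurePreserving_snd.ae hne] with z h1 h2
  by_cases hz : z ∈ Set.Ioi (0 : ℝ) ×ˢ Set.Ioi (0 : ℝ)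
  · rw [Set.indicator_of_mem hz, ← densityAlpha_coneMap hs h0 h hz.1 hz.2,
      ENNReal.ofReal_mul hS.le, mul_assoc, Pi.mul_apply]
  · rw [Set.indicator_of_notMem hz, Pi.mul_apply, densityAlpha, Set.indicator_of_notMem]
    · simp
    · intro hc
      have := nonneg_of_coneMap_mem_coneS h0 h hc
      exact hz ⟨lt_of_le_of_ne this.1 (Ne.symm h1), lt_of_le_of_ne this.2 (Ne.symm h2)⟩

/-! ### Sections of the quadrant and the law at angle `0` -/

lemma measurableSet_sheared (ε : ℝ) :
    MeasurableSet {z : ℝ × ℝ | 0 < z.2 ∧ 0 < z.1 + ε * z.2} :=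
  (measurableSet_lt measurable_const measurable_snd).inter
    (measurableSet_lt measurable_const (measurable_fst.add (measurable_snd.const_mul ε)))

lemma measurableSet_sheared_section (ε x : ℝ) : MeasurableSet {v : ℝ | 0 < v ∧ 0 < x + ε * v} :=
  (measurableSet_lt measurable_const measurable_id).inter
    (measurableSet_lt measurable_const ((measurable_id.const_mul ε).const_add x))

lemma setLIntegral_sheared_section (ε x : ℝ) (G : ℝ × ℝ → ENNReal) :
    ∫⁻ v in {v : ℝ | 0 < v ∧ 0 < x + ε * v}, G (x, v) =
      ∫⁻ v, {z : ℝ × ℝ | 0 < z.2 ∧ 0 < z.1 + ε * z.2}.indicator G (x, v) := by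
  rw [← lintegral_indicator (measurableSet_sheared_section ε x)]
  rfl

lemma measurable_setLIntegral_sheared (ε : ℝ) {G : ℝ × ℝ → ENNReal} (hG : Measurable G) :
    Measurable fun x => ∫⁻ v in {v : ℝ | 0 < v ∧ 0 < x + ε * v}, G (x, v) := by
  simp only [setLIntegral_sheared_section]
  exact (hG.indicator (measurableSet_sheared ε)).lintegral_prod_right'

/-- Shearing the quadrant along `u = x + ε v`. -/
lemma lintegral_quadrant_eq_sheared (ε : ℝ) {G : ℝ × ℝ → ENNReal} (hG : Measurable G) :
    ∫⁻ z, G z ∂quadrant =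
      ∫⁻ x, ∫⁻ v in {v : ℝ | 0 < v ∧ 0 < x + ε * v}, G (x + ε * v, v) := by
  have hQ : MeasurableSet (Set.Ioi (0 : ℝ) ×ˢ Set.Ioi (0 : ℝ)) :=
    measurableSet_Ioi.prod measurableSet_Ioi
  have hGi := hG.indicator hQ
  have hsh : Measurable fun z : ℝ × ℝ => (z.1 + ε * z.2, z.2) := by fun_prop
  have hGs : Measurable fun z : ℝ × ℝ => G (z.1 + ε * z.2, z.2) := hG.comp hsh
  simp only [fun x => setLIntegral_sheared_section ε x fun z => G (z.1 + ε * z.2, z.2)]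
  rw [quadrant, Measure.prod_restrict, ← lintegral_indicator hQ,
    lintegral_prod_symm _ hGi.aemeasurable,
    lintegral_lintegral_swap (f := fun x v => {z : ℝ × ℝ | 0 < z.2 ∧ 0 < z.1 + ε * z.2}.indicator
      (fun z => G (z.1 + ε * z.2, z.2)) (x, v))
      (hGs.indicator (measurableSet_sheared ε)).aemeasurable]
  refine lintegral_congr fun v => ?_
  rw [← lintegral_add_right_eq_self _ (ε * v)]
  refine lintegral_congr fun x => ?_
  by_cases h : 0 < v ∧ 0 < x + ε * v
  · rw [Set.indicator_of_mem, Set.indicator_of_mem]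
    · exact h
    · exact ⟨h.2, h.1⟩
  · rw [Set.indicator_of_notMem, Set.indicator_of_notMem]
    · exact h
    · exact fun hc => h ⟨hc.2, hc.1⟩

lemma coneMap_zero (z : ℝ × ℝ) : coneMap 0 z = ((z.1 + z.2 : ℝ) : ℂ) := by
  apply Complex.ext
  · rw [coneMap_re]; simp
  · rw [coneMap_im]; simp

lemma coneMap_pi_div_two (z : ℝ × ℝ) : coneMap (π / 2) z = Complex.I * ((z.1 - z.2 : ℝ) : ℂ) := by
  apply Complex.ext
  · rw [coneMap_re]; simp
  · rw [coneMap_im]; simp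

lemma coneMap_neg_pi_div_two (z : ℝ × ℝ) :
    coneMap (-(π / 2)) z = Complex.I * ((-(z.1 - z.2) : ℝ) : ℂ) := by
  apply Complex.ext
  · rw [coneMap_re]; simp
  · rw [coneMap_im]; simp

lemma two_mul_besselK_two_div {s : ℝ} (p : ℝ) (hs : 0 < s) :
    (2 * besselK p ((2 / s : ℝ) : ℂ)) = ((2 * (besselK p ((2 / s : ℝ) : ℂ)).re : ℝ) : ℂ) ∧
    ∫⁻ t in Set.Ioi (0 : ℝ), ENNReal.ofReal (t ^ (-p - 1) * exp (-(1 / s) * (t + 1 / t))) =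
      ENNReal.ofReal (2 * (besselK p ((2 / s : ℝ) : ℂ)).re) ∧
    0 ≤ 2 * (besselK p ((2 / s : ℝ) : ℂ)).re := by
  have hre : 0 < (((2 / s : ℝ) : ℂ)).re := by rw [Complex.ofReal_re]; positivity
  have hi := integrable_exp_sub_mul_cosh (-p) hre
  have hcast : ∀ t : ℝ, Complex.exp ((-p : ℝ) * t - ((2 / s : ℝ) : ℂ) * Complex.cosh t) =
      ((exp (-p * t - 2 / s * cosh t) : ℝ) : ℂ) := by intro t; push_cast; rfl
  simp only [hcast] at hi
  have hir : Integrable fun t : ℝ => exp (-p * t - 2 / s * cosh t) := by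
    simpa only [RCLike.re_eq_complex_re, Complex.ofReal_re] using hi.re
  have hK : 2 * besselK p ((2 / s : ℝ) : ℂ) =
      ((∫ t : ℝ, exp (-p * t - 2 / s * cosh t) : ℝ) : ℂ) := by
    rw [two_mul_besselK, ← integral_complex_ofReal]
    simp only [← hcast, Complex.ofReal_neg]
  have hK' : 2 * (besselK p ((2 / s : ℝ) : ℂ)).re = ∫ t : ℝ, exp (-p * t - 2 / s * cosh t) := by
    have := congrArg Complex.re hK
    rw [Complex.ofReal_re] at this
    rw [← this]; simp
  refine ⟨by rw [hK, hK'], ?_, hK' ▸ integral_nonneg fun t => (exp_pos _).le⟩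
  rw [hK', ofReal_integral_eq_lintegral_ofReal hir (ae_of_all _ fun t => (exp_pos _).le),
    lintegral_Ioi_eq_lintegral_exp]
  refine lintegral_congr fun t => ?_
  rw [← ENNReal.ofReal_mul (exp_pos _).le, ← exp_mul, ← exp_add, ← exp_add, cosh_eq, exp_neg]
  congr 2
  ring

lemma coneMass_zero {s : ℝ} (p : ℝ) (hs : 0 < s) :
    coneMass p s 0 = (2 * (besselK p ((2 / s : ℝ) : ℂ)).re) ^ 2 := by
  rw [coneMass_eq hs (by rw [abs_zero]; positivity), two_div_mul_exp_eq]
  simp only [Complex.ofReal_zero, zero_mul, Complex.exp_zero, mul_one]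
  rw [(two_mul_besselK_two_div p hs).1, Complex.norm_real, norm_eq_abs, sq_abs]

/-- On the line `u + v = x` the exponent involves `1/v + x²/u`. The variable `t = 1/v - 1/x` turns
this into `(x + 1/x) + (t + 1/t)`, so the weight separates. The prefactor `x² / (1 + xt)²` is the
Jacobian. -/
lemma coneWeight_zero_subst {s : ℝ} (p : ℝ) {x t : ℝ} (hs : 0 < s) (hx : 0 < x) (ht : 0 < t) :
    x ^ 2 / (1 + x * t) ^ 2 * coneWeight p s 0 (x + -1 * (x / (1 + x * t))) (x / (1 + x * t)) =
      x ^ (-p - 1) * exp (-(1 / s) * (x + 1 / x)) *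
        (t ^ (-p - 1) * exp (-(1 / s) * (t + 1 / t))) := by
  have h1 : 0 < 1 + x * t := by positivity
  have e1 : x + -1 * (x / (1 + x * t)) = x * x * t / (1 + x * t) := by field_simp; ring
  rw [e1, coneWeight]
  have e2 : -(1 / s) * (1 / (x / (1 + x * t)) + x * x * t / (1 + x * t) +
      (x / (1 + x * t)) ^ 2 / (x * x * t / (1 + x * t)) +
      2 * (x / (1 + x * t)) * cos (2 * 0)) =
      -(1 / s) * (x + 1 / x) + -(1 / s) * (t + 1 / t) := by
    rw [mul_zero, cos_zero]; field_simp; ring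
  rw [e2, exp_add, div_rpow (by positivity) h1.le, div_rpow hx.le h1.le,
    mul_rpow (by positivity) ht.le, mul_rpow hx.le hx.le]
  have e3 : (1 + x * t) ^ (p - 1) * (1 + x * t) ^ (-p - 1) * (1 + x * t) ^ 2 = 1 := by
    rw [← rpow_two, ← rpow_add h1, ← rpow_add h1]
    ring_nf
    exact rpow_zero _
  have e4 : x ^ 2 * (x ^ (-p - 1) * x ^ (p - 1)) = 1 := by
    rw [← rpow_two, ← rpow_add hx, ← rpow_add hx]
    ring_nf
    exact rpow_zero _
  have q1 : 0 < (1 + x * t) ^ (p - 1) := by positivity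
  have q2 : 0 < (1 + x * t) ^ (-p - 1) := by positivity
  field_simp
  rw [show (1 + x * t) ^ 2 * (1 + x * t) ^ (-p - 1) * (1 + x * t) ^ (p - 1) = 1 by linarith]
  linear_combination e4

lemma lintegral_coneWeight_zero_section {s : ℝ} (p : ℝ) {x : ℝ} (hs : 0 < s) (hx : 0 < x) :
    ∫⁻ v in {v : ℝ | 0 < v ∧ 0 < x + -1 * v}, ENNReal.ofReal (coneWeight p s 0 (x + -1 * v) v) =
      ENNReal.ofReal (x ^ (-p - 1) * exp (-(1 / s) * (x + 1 / x))) *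
        ENNReal.ofReal (2 * (besselK p ((2 / s : ℝ) : ℂ)).re) := by
  have himg : (fun t : ℝ => x / (1 + x * t)) '' Set.Ioi 0 = {v : ℝ | 0 < v ∧ 0 < x + -1 * v} := by
    ext v
    constructor
    · rintro ⟨t, ht, rfl⟩
      have ht : 0 < t := ht
      have h1 : 0 < 1 + x * t := by positivity
      refine ⟨by positivity, ?_⟩
      have : x + -1 * (x / (1 + x * t)) = x * x * t / (1 + x * t) := by field_simp; ring
      rw [this]; positivity
    · rintro ⟨h1, h2⟩
      refine ⟨(x + -1 * v) / (x * v), Set.mem_Ioi.2 (by positivity), ?_⟩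
      have : 1 + x * ((x + -1 * v) / (x * v)) = x / v := by field_simp; ring
      simp only [this, div_div_cancel₀ hx.ne']
  have hder : ∀ t ∈ Set.Ioi (0 : ℝ), HasDerivWithinAt (fun t : ℝ => x / (1 + x * t))
      (-(x ^ 2 / (1 + x * t) ^ 2)) (Set.Ioi 0) t := by
    intro t ht
    have ht : 0 < t := ht
    have h1 : 1 + x * t ≠ 0 := by positivity
    have h2 : HasDerivAt (fun t : ℝ => 1 + x * t) x t := by
      simpa using ((hasDerivAt_id t).const_mul x).const_add 1
    have := (hasDerivAt_const t x).div h2 h1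
    refine this.hasDerivWithinAt.congr_deriv ?_
    ring
  have hinj : Set.InjOn (fun t : ℝ => x / (1 + x * t)) (Set.Ioi 0) := by
    intro t ht t' ht' h
    have ht : 0 < t := ht
    have ht' : 0 < t' := ht'
    have h1 : 0 < 1 + x * t := by positivity
    have h1' : 0 < 1 + x * t' := by positivity
    simp only at h
    rw [div_eq_div_iff h1.ne' h1'.ne'] at h
    have := mul_left_cancel₀ hx.ne' h
    exact (mul_left_cancel₀ hx.ne' (add_left_cancel this)).symm
  rw [← himg, lintegral_image_eq_lintegral_abs_deriv_mul measurableSet_Ioi hder hinj,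
    ← (two_mul_besselK_two_div p hs).2.1, ← lintegral_const_mul _ (by fun_prop)]
  refine setLIntegral_congr_fun measurableSet_Ioi fun t ht => ?_
  have ht : 0 < t := ht
  rw [abs_neg, abs_of_nonneg (by positivity), ← ENNReal.ofReal_mul (by positivity),
    coneWeight_zero_subst p hs hx ht, ENNReal.ofReal_mul (by positivity)]

lemma nuZero_eq_coneLaw {s : ℝ} (p : ℝ) (hs : 0 < s) : nuZero p s = coneLaw p s 0 := by
  obtain ⟨-, -, hk⟩ := two_mul_besselK_two_div p hs
  have hM := coneMass_zero p hs
  have hM0 := coneMass_pos p 0 hs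
  have hdm : Measurable (densityZero p s) := by unfold densityZero; fun_prop
  refine Measure.ext_of_lintegral _ fun g hg => ?_
  have hgc : Measurable fun x : ℝ => g (x : ℂ) := hg.comp Complex.measurable_ofReal
  have hcm := (continuous_coneMap 0).measurable
  rw [lintegral_coneLaw p s 0 hg, nuZero, lintegral_map hg Complex.measurable_ofReal,
    lintegral_withDensity_eq_lintegral_mul _ (by fun_prop) hgc,
    lintegral_quadrant_eq_sheared (-1) (by fun_prop), ← lintegral_indicator measurableSet_Ioi]
  refine lintegral_congr fun x => ?_
  by_cases hx : x ∈ Set.Ioi (0 : ℝ)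
  · rw [Set.indicator_of_mem hx, Pi.mul_apply]
    have hx : 0 < x := hx
    have h1 : ∀ v, coneMap 0 (x + -1 * v, v) = (x : ℂ) := fun v => by
      rw [coneMap_zero]; congr 1; ring
    have hcw : Measurable fun v => coneWeight p s 0 (x + -1 * v) v :=
      (measurable_coneWeight p s 0).comp (by fun_prop : Measurable fun v : ℝ => (x + -1 * v, v))
    simp only [h1, ENNReal.ofReal_mul (inv_nonneg.2 hM0.le)]
    rw [lintegral_mul_const _ (by fun_prop), lintegral_const_mul _ (by fun_prop),
      lintegral_coneWeight_zero_section p hs hx, ← ENNReal.ofReal_mul (by positivity),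
      ← ENNReal.ofReal_mul (inv_nonneg.2 hM0.le), densityZero, hM]
    -- The mass at angle `0` is the square of `2 K_p(2/s)`, so its positivity shows that `K_p(2/s)`
    -- does not vanish.
    rw [hM] at hM0
    have hk0 : 2 * (besselK p ((2 / s : ℝ) : ℂ)).re ≠ 0 := fun h => by
      rw [h] at hM0; simp at hM0
    congr 2
    field_simp
  · rw [Set.indicator_of_notMem hx]
    have : {v : ℝ | 0 < v ∧ 0 < x + -1 * v} = ∅ := by
      ext v
      simp only [Set.mem_Ioi, not_lt] at hx
      constructor
      · rintro ⟨h1, h2⟩; exfalso; linarith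
      · exact fun h => h.elim
    rw [this, Measure.restrict_empty, lintegral_zero_measure]

/-! ### The laws at angles `±π/2` -/

/-- The domain of integration in the definition of `fPlus`. -/
noncomputable abbrev fPlusDomain (y : ℝ) : Set ℝ := if 0 < y then Set.Ioo 0 y else Set.Iio y

lemma mem_fPlusDomain {y t : ℝ} (hy : y ≠ 0) : t ∈ fPlusDomain y ↔ 0 < y - t ∧ 0 < y * t := by
  unfold fPlusDomain
  rcases hy.lt_or_gt with h | h
  · rw [if_neg h.not_gt, Set.mem_Iio, sub_pos]
    exact ⟨fun ht => ⟨ht, mul_pos_of_neg_of_neg h (ht.trans h)⟩, fun ht => ht.1⟩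
  · rw [if_pos h, Set.mem_Ioo, sub_pos, mul_pos_iff_of_pos_left h, and_comm]

lemma measurableSet_fPlusDomain (y : ℝ) : MeasurableSet (fPlusDomain y) := by
  unfold fPlusDomain
  split_ifs
  · exact measurableSet_Ioo
  · exact measurableSet_Iio

/-- On the line `u - v = y` the exponent involves `1/v + y²/u`. With `1/v = 1/t - 1/y` one has `u =
y²/(y - t)`, and it becomes `(1/t - t) - (1/y - y)`. The conditions `u, v > 0` say that `t < y` has
the sign of `y`, which accounts for the lower limit `c(y)`. -/
lemma coneWeight_pi_div_two_subst {s : ℝ} (p : ℝ) {y t : ℝ} (hs : 0 < s) (h1 : 0 < y - t)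
    (h2 : 0 < y * t) :
    y ^ 2 / (y - t) ^ 2 * coneWeight p s (π / 2) (y + 1 * (y * t / (y - t))) (y * t / (y - t)) =
      1 / |y| ^ (p + 1) * exp ((1 / s) * (1 / y - y)) *
        (exp (-(1 / s) * (1 / t - t)) * |t| ^ (p - 1)) := by
  have hy : y ≠ 0 := left_ne_zero_of_mul h2.ne'
  have ht : t ≠ 0 := right_ne_zero_of_mul h2.ne'
  have hy0 : 0 < |y| := abs_pos.2 hy
  have ht0 : 0 < |t| := abs_pos.2 ht
  have e1 : y + 1 * (y * t / (y - t)) = |y| * |y| / (y - t) := by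
    rw [abs_mul_abs_self]; field_simp; ring
  have e2 : -(1 / s) * (1 / (y * t / (y - t)) + |y| * |y| / (y - t) +
      (y * t / (y - t)) ^ 2 / (|y| * |y| / (y - t)) +
      2 * (y * t / (y - t)) * cos (2 * (π / 2))) =
      (1 / s) * (1 / y - y) + -(1 / s) * (1 / t - t) := by
    rw [mul_div_cancel₀ _ two_ne_zero, cos_pi, abs_mul_abs_self]; field_simp; ring
  rw [e1, coneWeight, e2, exp_add, div_rpow (by positivity) h1.le, div_rpow h2.le h1.le,
    mul_rpow hy0.le hy0.le, ← abs_of_pos h2, abs_mul, mul_rpow hy0.le ht0.le, ← sq_abs y]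
  have e3 : (y - t) ^ (p - 1) * (y - t) ^ (-p - 1) * (y - t) ^ 2 = 1 := by
    rw [← rpow_two, ← rpow_add h1, ← rpow_add h1]
    ring_nf
    exact rpow_zero _
  have e4 : |y| ^ 2 * (|y| ^ (-p - 1) * |y| ^ (-p - 1) * |y| ^ (p - 1)) * |y| ^ (p + 1) = 1 := by
    rw [← rpow_two, ← rpow_add hy0, ← rpow_add hy0, ← rpow_add hy0, ← rpow_add hy0]
    ring_nf
    exact rpow_zero _
  have q1 : 0 < (y - t) ^ (p - 1) := by positivity
  have q2 : 0 < (y - t) ^ (-p - 1) := by positivity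
  have q3 : 0 < |y| ^ (p + 1) := by positivity
  have e5 : 1 / |y| ^ (p + 1) = |y| ^ 2 * (|y| ^ (-p - 1) * |y| ^ (-p - 1) * |y| ^ (p - 1)) := by
    rw [div_eq_iff q3.ne', e4]
  rw [e5]
  have e6 : 1 / (y - t) ^ 2 * (1 / (y - t) ^ (-p - 1)) * (1 / (y - t) ^ (p - 1)) = 1 := by
    rw [one_div_mul_one_div, one_div_mul_one_div,
      show (y - t) ^ 2 * (y - t) ^ (-p - 1) * (y - t) ^ (p - 1) = 1 by linarith, one_div_one]
  linear_combination (|y| ^ 2 * (|y| ^ (-p - 1) * |y| ^ (-p - 1) * |y| ^ (p - 1)) * |t| ^ (p - 1) *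
    exp ((1 / s) * (1 / y - y)) * exp (-(1 / s) * (1 / t - t))) * e6

/-- The integral of the limiting weight along the line `u - v = y`. -/
noncomputable def piHalfSection (p s y : ℝ) : ENNReal :=
  ∫⁻ v in {v : ℝ | 0 < v ∧ 0 < y + 1 * v}, ENNReal.ofReal (coneWeight p s (π / 2) (y + 1 * v) v)

lemma measurable_piHalfSection (p s : ℝ) : Measurable (piHalfSection p s) := by
  have := measurable_coneWeight p s (π / 2)
  have h : Measurable fun z : ℝ × ℝ => (z.1 + 1 * z.2, z.2) := by fun_prop
  exact measurable_setLIntegral_sheared 1 (this.comp h).ennreal_ofReal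

lemma piHalfSection_eq {s : ℝ} (p : ℝ) {y : ℝ} (hs : 0 < s) (hy : y ≠ 0) :
    piHalfSection p s y = ENNReal.ofReal (1 / |y| ^ (p + 1) * exp ((1 / s) * (1 / y - y))) *
      ∫⁻ t in fPlusDomain y, ENNReal.ofReal (exp (-(1 / s) * (1 / t - t)) * |t| ^ (p - 1)) := by
  have hden : ∀ t ∈ fPlusDomain y, y - t ≠ 0 := fun t ht => ((mem_fPlusDomain hy).1 ht).1.ne'
  have himg : (fun t : ℝ => y * t / (y - t)) '' fPlusDomain y = {v : ℝ | 0 < v ∧ 0 < y + 1 * v} := by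
    ext v
    constructor
    · rintro ⟨t, ht, rfl⟩
      obtain ⟨h1, h2⟩ := (mem_fPlusDomain hy).1 ht
      refine ⟨by positivity, ?_⟩
      have : y + 1 * (y * t / (y - t)) = y * y / (y - t) := by field_simp; ring
      rw [this]; exact div_pos (mul_self_pos.2 hy) h1
    · rintro ⟨h1, h2⟩
      have h3 : y + v ≠ 0 := by rw [one_mul] at h2; exact h2.ne'
      have e1 : y - y * v / (y + 1 * v) = y ^ 2 / (y + 1 * v) := by
        rw [one_mul]; field_simp; ring
      refine ⟨y * v / (y + 1 * v), (mem_fPlusDomain hy).2 ⟨?_, ?_⟩, ?_⟩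
      · rw [e1]; positivity
      · have : y * (y * v / (y + 1 * v)) = y ^ 2 * v / (y + 1 * v) := by ring
        rw [this]; positivity
      · simp only [e1]; simp only [one_mul]; field_simp
  have hder : ∀ t ∈ fPlusDomain y, HasDerivWithinAt (fun t : ℝ => y * t / (y - t))
      (y ^ 2 / (y - t) ^ 2) (fPlusDomain y) t := by
    intro t ht
    have h2 : HasDerivAt (fun t : ℝ => y - t) (-1) t := by
      simpa using (hasDerivAt_id t).const_sub y
    have h3 : HasDerivAt (fun t : ℝ => y * t) y t := by
      simpa using (hasDerivAt_id t).const_mul y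
    refine (h3.div h2 (hden t ht)).hasDerivWithinAt.congr_deriv ?_
    ring
  have hinj : Set.InjOn (fun t : ℝ => y * t / (y - t)) (fPlusDomain y) := by
    intro t ht t' ht' h
    simp only at h
    rw [div_eq_div_iff (hden t ht) (hden t' ht')] at h
    have : y ^ 2 * t = y ^ 2 * t' := by linear_combination h
    exact mul_left_cancel₀ (pow_ne_zero 2 hy) this
  rw [piHalfSection, ← himg, lintegral_image_eq_lintegral_abs_deriv_mul
    (measurableSet_fPlusDomain y) hder hinj, ← lintegral_const_mul _ (by fun_prop)]
  refine setLIntegral_congr_fun (measurableSet_fPlusDomain y) fun t ht => ?_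
  obtain ⟨h1, h2⟩ := (mem_fPlusDomain hy).1 ht
  rw [abs_of_nonneg (by positivity), ← ENNReal.ofReal_mul (by positivity),
    coneWeight_pi_div_two_subst p hs h1 h2, ENNReal.ofReal_mul (by positivity)]

/-- No integrability of the section is needed: a divergent integral is `0` on both sides. Finiteness
for almost every `y` follows later from the finite total mass. -/
lemma fPlus_eq_toReal {s : ℝ} (p : ℝ) {y : ℝ} (hs : 0 < s) (hy : y ≠ 0) :
    fPlus p s y = (piHalfSection p s y).toReal := by
  rw [piHalfSection_eq p hs hy, ENNReal.toReal_mul, ENNReal.toReal_ofReal (by positivity), fPlus,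
    integral_eq_lintegral_of_nonneg_ae (ae_of_all _ fun t => by
      simp only [Pi.zero_apply]; positivity) (Measurable.aestronglyMeasurable (by fun_prop))]

lemma ae_ne_zero : ∀ᵐ y : ℝ, y ≠ 0 := compl_mem_ae_iff.2 (measure_singleton 0)

lemma lintegral_piHalfSection_mul {s : ℝ} (p : ℝ) {h : ℝ → ENNReal} (hh : Measurable h) :
    ∫⁻ y, piHalfSection p s y * h y =
      ∫⁻ z, ENNReal.ofReal (coneWeight p s (π / 2) z.1 z.2) * h (z.1 - z.2) ∂quadrant := by
  have hcw := measurable_coneWeight p s (π / 2)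
  rw [lintegral_quadrant_eq_sheared 1 (by fun_prop)]
  refine lintegral_congr fun y => ?_
  have e : ∀ v : ℝ, y + 1 * v - v = y := fun v => by ring
  simp only [e]
  have hcw' : Measurable fun v => coneWeight p s (π / 2) (y + 1 * v) v :=
    hcw.comp (by fun_prop : Measurable fun v : ℝ => (y + 1 * v, v))
  rw [lintegral_mul_const _ (by fun_prop), piHalfSection]

lemma lintegral_piHalfSection {s : ℝ} (p : ℝ) (hs : 0 < s) :
    ∫⁻ y, piHalfSection p s y = ENNReal.ofReal (coneMass p s (π / 2)) := by
  have := lintegral_piHalfSection_mul (s := s) p (h := fun _ => 1) measurable_const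
  simp only [mul_one] at this
  rw [this, ofReal_coneMass p _ hs]

lemma piHalfSection_ae_lt_top {s : ℝ} (p : ℝ) (hs : 0 < s) :
    ∀ᵐ y, piHalfSection p s y < ⊤ :=
  ae_lt_top (measurable_piHalfSection p s) (by
    rw [lintegral_piHalfSection p hs]; exact ENNReal.ofReal_ne_top)

lemma fPlus_ae_eq {s : ℝ} (p : ℝ) (hs : 0 < s) :
    fPlus p s =ᵐ[volume] fun y => (piHalfSection p s y).toReal := by
  filter_upwards [ae_ne_zero] with y hy using fPlus_eq_toReal p hs hy

lemma integrable_fPlus {s : ℝ} (p : ℝ) (hs : 0 < s) : Integrable (fPlus p s) :=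
  (integrable_toReal_of_lintegral_ne_top (measurable_piHalfSection p s).aemeasurable (by
    rw [lintegral_piHalfSection p hs]; exact ENNReal.ofReal_ne_top)).congr (fPlus_ae_eq p hs).symm

lemma integral_fPlus {s : ℝ} (p : ℝ) (hs : 0 < s) :
    ∫ y, fPlus p s y = coneMass p s (π / 2) := by
  rw [integral_congr_ae (fPlus_ae_eq p hs), integral_toReal
    (measurable_piHalfSection p s).aemeasurable (piHalfSection_ae_lt_top p hs),
    lintegral_piHalfSection p hs, ENNReal.toReal_ofReal (coneMass_pos p _ hs).le]

lemma lintegral_fPlus_mul {s : ℝ} (p : ℝ) (hs : 0 < s) {h : ℝ → ENNReal} (hh : Measurable h) :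
    ∫⁻ y, ENNReal.ofReal (normConstPiHalf p s * fPlus p s y) * h y =
      ∫⁻ z, ENNReal.ofReal ((coneMass p s (π / 2))⁻¹ * coneWeight p s (π / 2) z.1 z.2) *
        h (z.1 - z.2) ∂quadrant := by
  have hc := (inv_pos.2 (coneMass_pos p (π / 2) hs)).le
  have hq := measurable_piHalfSection p s
  simp only [ENNReal.ofReal_mul hc, mul_assoc]
  rw [lintegral_const_mul _ (by fun_prop), ← lintegral_piHalfSection_mul p hh,
    ← lintegral_const_mul _ (by fun_prop)]
  refine lintegral_congr_ae ?_
  filter_upwards [fPlus_ae_eq p hs, piHalfSection_ae_lt_top p hs] with y h1 h2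
  rw [normConstPiHalf_eq p hs, ENNReal.ofReal_mul hc, h1, ENNReal.ofReal_toReal h2.ne, mul_assoc]

lemma nuPiHalf_eq_coneLaw {s : ℝ} (p : ℝ) (hs : 0 < s) : nuPiHalf p s = coneLaw p s (π / 2) := by
  have hm := (integrable_fPlus p hs).aestronglyMeasurable.aemeasurable
  refine Measure.ext_of_lintegral _ fun g hg => ?_
  have hI : Measurable fun y : ℝ => Complex.I * (y : ℂ) := by fun_prop
  have hgI : Measurable fun y : ℝ => g (Complex.I * (y : ℂ)) := hg.comp hI
  rw [lintegral_coneLaw p s _ hg, nuPiHalf, lintegral_map hg hI,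
    lintegral_withDensity_eq_lintegral_mul₀ (by fun_prop) hgI.aemeasurable]
  simp only [coneMap_pi_div_two, Pi.mul_apply]
  exact lintegral_fPlus_mul p hs hgI

lemma aemeasurable_fMinus {s : ℝ} (p : ℝ) (hs : 0 < s) : AEMeasurable (fMinus p s) :=
  (integrable_fPlus p hs).comp_neg.aestronglyMeasurable.aemeasurable

lemma nuNegPiHalf_eq_coneLaw {s : ℝ} (p : ℝ) (hs : 0 < s) :
    nuNegPiHalf p s = coneLaw p s (-(π / 2)) := by
  have hm := aemeasurable_fMinus p hs
  refine Measure.ext_of_lintegral _ fun g hg => ?_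
  have hI : Measurable fun y : ℝ => Complex.I * (y : ℂ) := by fun_prop
  have hgI : Measurable fun y : ℝ => g (Complex.I * (y : ℂ)) := hg.comp hI
  rw [lintegral_coneLaw p s _ hg, nuNegPiHalf, lintegral_map hg hI,
    lintegral_withDensity_eq_lintegral_mul₀ (by fun_prop) hgI.aemeasurable]
  simp only [coneMap_neg_pi_div_two, Pi.mul_apply, coneMass_neg, coneWeight_neg]
  -- The weight is even in `α`, so passing from `π/2` to `-π/2` only replaces `u - v` by its
  -- negative, that is, `f_+` by its reflection.
  rw [← lintegral_fPlus_mul p hs (h := fun y => g (Complex.I * ((-y : ℝ) : ℂ)))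
    (hgI.comp measurable_neg), ← lintegral_neg_eq_self]
  simp only [fMinus, neg_neg]

/-! ### Convergence in distribution and the main theorem -/

/-- Convergence in distribution of random variables whose laws are the cone laws. -/
lemma tendstoInDistribution_of_hasLaw_coneLaw {p s : ℝ} (hs : 0 < s) {ι : Type*} {l : Filter ι}
    {a : ι → ℝ} {a₀ : ℝ} (ha : Tendsto a l (𝓝 a₀)) {Ω : ι → Type*} [∀ i, MeasurableSpace (Ω i)]
    {P : (i : ι) → Measure (Ω i)} [∀ i, IsProbabilityMeasure (P i)] {Z : (i : ι) → Ω i → ℂ}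
    (hZ : ∀ i, HasLaw (Z i) (coneLaw p s (a i)) (P i)) {Ω₀ : Type*} [MeasurableSpace Ω₀]
    {P₀ : Measure Ω₀} [IsProbabilityMeasure P₀] {X : Ω₀ → ℂ}
    (hX : HasLaw X (coneLaw p s a₀) P₀) :
    TendstoInDistribution Z l X P P₀ where
  forall_aemeasurable i := (hZ i).aemeasurable
  aemeasurable_limit := hX.aemeasurable
  tendsto := by
    simp only [(hZ _).map_eq, hX.map_eq]
    exact ((continuous_coneLaw p hs).tendsto a₀).comp ha

theorem mainTheorem3 (p s : ℝ) (hp : 0 < p) (hs : 0 < s) :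
    -- the measures in question are probability measures
    (IsProbabilityMeasure (nuZero p s) ∧
      (∀ α : AlphaRange, IsProbabilityMeasure (nuAlpha p s α)) ∧
      IsProbabilityMeasure (nuPiHalf p s) ∧ IsProbabilityMeasure (nuNegPiHalf p s)) ∧
    -- convergence in distribution of random variables having these laws
    (∀ (Ω : AlphaRange → Type*) [∀ α, MeasurableSpace (Ω α)]
        (P : (α : AlphaRange) → Measure (Ω α)) [∀ α, IsProbabilityMeasure (P α)]
        (Z : (α : AlphaRange) → Ω α → ℂ) (_hZ : ∀ α, HasLaw (Z α) (nuAlpha p s α) (P α)),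
      (∀ (Ω₀ : Type*) [MeasurableSpace Ω₀] (P₀ : Measure Ω₀) [IsProbabilityMeasure P₀]
          (X : Ω₀ → ℂ) (_hX : HasLaw X (nuZero p s) P₀),
        TendstoInDistribution Z (comap Subtype.val (𝓝 (0 : ℝ))) X P P₀) ∧
      (∀ (Ω₁ : Type*) [MeasurableSpace Ω₁] (P₁ : Measure Ω₁) [IsProbabilityMeasure P₁]
          (iY : Ω₁ → ℂ) (_hY : HasLaw iY (nuPiHalf p s) P₁),
        TendstoInDistribution Z (comap Subtype.val (𝓝 (π / 2))) iY P P₁) ∧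
      (∀ (Ω₂ : Type*) [MeasurableSpace Ω₂] (P₂ : Measure Ω₂) [IsProbabilityMeasure P₂]
          (iY : Ω₂ → ℂ) (_hY : HasLaw iY (nuNegPiHalf p s) P₂),
        TendstoInDistribution Z (comap Subtype.val (𝓝 (-(π / 2)))) iY P P₂)) ∧
    -- identification of the normalisation constant at `α = ±π/2`
    (Integrable (fPlus p s) ∧ Integrable (fMinus p s) ∧
      0 < (∫ y, fPlus p s y) ∧
      (∫ y, fPlus p s y)⁻¹ = normConstPiHalf p s ∧
      (∫ y, fMinus p s y)⁻¹ = normConstPiHalf p s ∧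
      Tendsto (normConst p s) (𝓝[<] (π / 2)) (𝓝 (normConstPiHalf p s)) ∧
      Tendsto (normConst p s) (𝓝[>] (-(π / 2))) (𝓝 (normConstPiHalf p s))) := by
  have hα : ∀ α : AlphaRange, nuAlpha p s α = coneLaw p s α := fun α =>
    nuAlpha_eq_coneLaw p hs α.2.1 α.2.2
  have hmass := coneMass_pos p (π / 2) hs
  have hpi : (0 : ℝ) < π / 2 := by positivity
  have hint : (∫ y, fPlus p s y)⁻¹ = normConstPiHalf p s := by
    rw [integral_fPlus p hs, normConstPiHalf_eq p hs]
  have hnorm : Continuous fun α => (coneMass p s α)⁻¹ :=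
    (continuous_coneMass p hs).inv₀ fun α => (coneMass_pos p α hs).ne'
  refine ⟨⟨?_, fun α => ?_, ?_, ?_⟩, ?_, integrable_fPlus p hs, (integrable_fPlus p hs).comp_neg,
    ?_, hint, ?_, ?_, ?_⟩
  · rw [nuZero_eq_coneLaw p hs]; exact isProbabilityMeasure_coneLaw p _ hs
  · rw [hα]; exact isProbabilityMeasure_coneLaw p _ hs
  · rw [nuPiHalf_eq_coneLaw p hs]; exact isProbabilityMeasure_coneLaw p _ hs
  · rw [nuNegPiHalf_eq_coneLaw p hs]; exact isProbabilityMeasure_coneLaw p _ hs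
  · intro Ω _ P _ Z hZ
    have hZ' : ∀ α, HasLaw (Z α) (coneLaw p s α) (P α) := fun α => hα α ▸ hZ α
    refine ⟨fun Ω₀ _ P₀ _ X hX => ?_, fun Ω₁ _ P₁ _ iY hY => ?_, fun Ω₂ _ P₂ _ iY hY => ?_⟩
    · exact tendstoInDistribution_of_hasLaw_coneLaw hs tendsto_comap hZ'
        (nuZero_eq_coneLaw p hs ▸ hX)
    · exact tendstoInDistribution_of_hasLaw_coneLaw hs tendsto_comap hZ'
        (nuPiHalf_eq_coneLaw p hs ▸ hY)
    · exact tendstoInDistribution_of_hasLaw_coneLaw hs tendsto_comap hZ'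
        (nuNegPiHalf_eq_coneLaw p hs ▸ hY)
  · rw [integral_fPlus p hs]; exact hmass
  · rw [← hint]
    unfold fMinus
    rw [integral_neg_eq_self]
  · have := (hnorm.tendsto (π / 2)).mono_left (nhdsWithin_le_nhds (s := Set.Iio (π / 2)))
    rw [← normConstPiHalf_eq p hs] at this
    refine this.congr' ?_
    filter_upwards [Ioo_mem_nhdsLT hpi] with α h
    rw [normConst_eq hs (abs_lt.2 ⟨by linarith [h.1], h.2⟩)]
  · have := (hnorm.tendsto (-(π / 2))).mono_left (nhdsWithin_le_nhds (s := Set.Ioi (-(π / 2))))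
    rw [coneMass_neg, ← normConstPiHalf_eq p hs] at this
    refine this.congr' ?_
    filter_upwards [Ioo_mem_nhdsGT (neg_lt_zero.2 hpi)] with α h
    rw [normConst_eq hs (abs_lt.2 ⟨h.1, by linarith [h.2]⟩)]
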